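/- Let $\mathbb K$ be an algebraically closed field, let $V$ be an $n$-dimensional $\mathbb K$-vector space, and let $k,l<n$ be positive integers. Let $B\subset \mathrm{GL}(V)$ be a Borel subgroup, i.e. the stabilizer of a complete flag $V_1\subset\dots\subset V_n=V$; choose a basis $v_1,\dots,v_n$ of $V$ with $V_i=\langle v_1,\dots,v_i\rangle$, let $s_i\in\mathrm{GL}(V)$ exchange $v_i$ and $v_{i+1}$ and fix the other $v_j$, and let $P_i=B\cup Bs_iB$ ($1\le i\le n-1$) be the minimal parabolic subgroups containing $B$. The group $\mathrm{GL}(V)$ acts diagonally on $X=\mathrm{Gr}(k,V)\times\mathrm{Gr}(l,V)$, the variety of pairs $(U,W)$ of subspaces of $V$ with $\dim U=k$ and $\dim W=l$. For $B$-orbits $\mathcal O,\mathcal O'$ in $X$ write $\mathcal O\preceq\mathcal O'$ (weak order) if there is a finite (possibly empty) sequence $i_1,\dots,i_r$ with $\overline{\mathcal O'}=P_{i_r}\cdots P_{i_1}\overline{\mathcal O}$, where the bar denotes Zariski closure in $X$; call a $B$-orbit $\mathcal O$ minimal if $\mathcal O'\preceq\mathcal O$ implies $\mathcal O'=\mathcal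 O$ for every $B$-orbit $\mathcal O'$ in $X$. A Schubert cell is a $B$-orbit in a Grassmannian $\mathrm{Gr}(m,V)$. Let $d$ be an integer with $\max(k+l-n,0)\le d\le\min(k,l)$ and let $X_d=\{(U,W)\in X:\dim(U\cap W)=d\}$. Then $X_d$ is a single $\mathrm{GL}(V)$-orbit, and it contains exactly $\binom{k+l-2d}{k-d}$ minimal $B$-orbits. Each of these orbits is closed in $X_d$ (for the Zariski topology), has dimension $(k-d)(l-d)$, and is a direct product $C\times C'$ of a Schubert cell $C\subset\mathrm{Gr}(k,V)$ and a Schubert cell $C'\subset\mathrm{Gr}(l,V)$. -/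

import Mathlib

open scoped Pointwise

namespace DoubleGrassmannian

section Zariski

variable (K E : Type*) [Field K] [AddCommGroup E] [Module K E]

/-- The common zero locus in the vector space `E` of a set of polynomials in the linear
functionals on `E` (that is, of a set of polynomial functions on `E`). -/
def zeros (S : Set (MvPolynomial (Module.Dual K E) K)) : Set E :=
  {x | ∀ p ∈ S, MvPolynomial.eval (fun f : Module.Dual K E => f x) p = 0}

/-- The Zariski topology on (the `K`-points of) the affine space `E`: the closed sets are the
common zero loci of sets of polynomial functions. -/
abbrev zariskiAffine : TopologicalSpace E :=
  TopologicalSpace.ofClosed {Z | ∃ S, Z = zeros K E S}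
    ⟨{1}, by ext x; simp [zeros]⟩
    (by
      intro A hA
      refine ⟨⋃₀ {S | zeros K E S ∈ A}, ?_⟩
      ext x
      simp only [Set.mem_sInter, zeros, Set.mem_sUnion, Set.mem_ofPred_eq]
      constructor
      · rintro h p ⟨S, hS, hp⟩
        exact h _ hS p hp
      · intro h Z hZ
        obtain ⟨S, rfl⟩ := hA hZ
        exact fun p hp => h p ⟨S, hZ, hp⟩)
    (by
      rintro _ ⟨S, rfl⟩ _ ⟨T, rfl⟩
      refine ⟨S * T, ?_⟩
      ext x
      simp only [zeros, Set.mem_union, Set.mem_ofPred_eq]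
      constructor
      · rintro (h | h) _ ⟨p, hp, q, hq, rfl⟩
        · simp [h p hp]
        · simp [h q hq]
      · intro h
        by_contra hc
        push Not at hc
        obtain ⟨⟨p, hp, hp0⟩, q, hq, hq0⟩ := hc
        have := h _ (Set.mul_mem_mul hp hq)
        rw [map_mul] at this
        exact (mul_ne_zero hp0 hq0) this)

end Zariski

section Grassmannians

variable (K V : Type*) [Field K] [AddCommGroup V] [Module K V]

/-- The Grassmannian `Gr(k, V)` of `k`-dimensional subspaces of `V`. -/
@[ext]
structure Gr (k : ℕ) where
  /-- the subspace -/
  space : Submodule K V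
  finrank_space : Module.finrank K space = k

/-- `GL(V)` acts on `Gr(k, V)` by taking images of subspaces. -/
instance (k : ℕ) : MulAction (V ≃ₗ[K] V) (Gr K V k) where
  smul g U := ⟨U.space.map (g : V →ₗ[K] V),
    (LinearEquiv.finrank_map_eq g U.space).trans U.finrank_space⟩
  one_smul U := Gr.ext (Submodule.map_id U.space)
  mul_smul g h U := Gr.ext (Submodule.map_comp (h : V →ₗ[K] V) (g : V →ₗ[K] V) U.space)

/-- The set `X = Gr(k, V) × Gr(l, V)` of pairs `(U, W)`. It is a type of its own, because its
Zariski topology is not the product of the two Zariski topologies. -/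
@[ext]
structure X (k l : ℕ) where
  /-- the `k`-dimensional subspace -/
  U : Gr K V k
  /-- the `l`-dimensional subspace -/
  W : Gr K V l

/-- The diagonal action of `GL(V)` on `X`. -/
instance (k l : ℕ) : MulAction (V ≃ₗ[K] V) (X K V k l) where
  smul g x := ⟨g • x.U, g • x.W⟩
  one_smul x := X.ext (one_smul _ x.U) (one_smul _ x.W)
  mul_smul g h x := X.ext (mul_smul g h x.U) (mul_smul g h x.W)

/-- Pairs of frames: a linearly independent `k`-tuple and a linearly independent `l`-tuple. -/
structure Frames (k l : ℕ) where
  /-- the `k`-tuple -/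
  u : Fin k → V
  /-- the `l`-tuple -/
  w : Fin l → V
  linearIndependent_u : LinearIndependent K u
  linearIndependent_w : LinearIndependent K w

variable {K V} in
/-- The pair of subspaces spanned by a pair of frames. -/
def Frames.span {k l : ℕ} (p : Frames K V k l) : X K V k l where
  U := ⟨Submodule.span K (Set.range p.u),
    (finrank_span_eq_card p.linearIndependent_u).trans (Fintype.card_fin k)⟩
  W := ⟨Submodule.span K (Set.range p.w),
    (finrank_span_eq_card p.linearIndependent_w).trans (Fintype.card_fin l)⟩

/-- The Zariski topology on the set of pairs of frames, as a subset of the affine space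
`V^k × V^l`. -/
instance (k l : ℕ) : TopologicalSpace (Frames K V k l) :=
  TopologicalSpace.induced (fun p => (p.u, p.w))
    (zariskiAffine K ((Fin k → V) × (Fin l → V)))

/-- The Zariski topology on `X = Gr(k, V) × Gr(l, V)`, as the quotient of the variety of pairs of
frames by `GL_k × GL_l`: a set of pairs of subspaces is closed if and only if the pairs of frames
that span its members are cut out, among all pairs of frames, by polynomial equations. -/
instance (k l : ℕ) : TopologicalSpace (X K V k l) :=
  TopologicalSpace.coinduced Frames.span inferInstance

/-- The set `X_d` of the pairs `(U, W)` with `dim (U ∩ W) = d`. -/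
def stratum (k l d : ℕ) : Set (X K V k l) :=
  {x | Module.finrank K (x.U.space ⊓ x.W.space : Submodule K V) = d}

end Grassmannians

section Borel

variable {K V : Type*} [Field K] [AddCommGroup V] [Module K V] {n : ℕ}

/-- The Borel subgroup `B` of `GL(V)`: the stabilizer of the complete flag
`V_i = ⟨v_1, …, v_i⟩`. -/
def borelSubgroup (v : Module.Basis (Fin n) K V) : Subgroup (V ≃ₗ[K] V) :=
  ⨅ i : Fin (n + 1), MulAction.stabilizer (V ≃ₗ[K] V) (v.flag i)

/-- (A representative in `GL(V)` of) the simple reflection `s_i`: it exchanges two neighbouring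
basis vectors. The index `i` runs over `0, …, n - 2`. -/
noncomputable def simpleReflection (v : Module.Basis (Fin n) K V) (i : Fin (n - 1)) :
    V ≃ₗ[K] V :=
  v.equiv v (Equiv.swap ⟨i, by omega⟩ ⟨i + 1, by omega⟩)

/-- The minimal parabolic subgroup `P_i = B ∪ B s_i B`, as a subset of `GL(V)`. -/
def minimalParabolic (v : Module.Basis (Fin n) K V) (i : Fin (n - 1)) : Set (V ≃ₗ[K] V) :=
  (borelSubgroup v : Set (V ≃ₗ[K] V)) ∪
    DoubleCoset.doubleCoset (simpleReflection v i) (borelSubgroup v) (borelSubgroup v)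

/-- `O` is a `B`-orbit in `X = Gr(k, V) × Gr(l, V)`. -/
def IsBorelOrbit (v : Module.Basis (Fin n) K V) {k l : ℕ} (O : Set (X K V k l)) : Prop :=
  ∃ x : X K V k l, O = MulAction.orbit (borelSubgroup v) x

/-- `C` is a Schubert cell, that is, a `B`-orbit in `Gr(k, V)`. -/
def IsSchubertCell (v : Module.Basis (Fin n) K V) {k : ℕ} (C : Set (Gr K V k)) : Prop :=
  ∃ U : Gr K V k, C = MulAction.orbit (borelSubgroup v) U

/-- The weak order: the Zariski closure of `O'` is `P_{i_r} ⋯ P_{i_1}` applied to the Zariski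
closure of `O`, for some sequence `i_1, …, i_r`. -/
def WeakLE (v : Module.Basis (Fin n) K V) {k l : ℕ} (O O' : Set (X K V k l)) : Prop :=
  ∃ L : List (Fin (n - 1)),
    closure O' = L.foldl (fun Z i => minimalParabolic v i • Z) (closure O)

/-- `O` is a minimal element of the set of `B`-orbits in `X` with respect to the weak order. -/
def IsMinimalOrbit (v : Module.Basis (Fin n) K V) {k l : ℕ} (O : Set (X K V k l)) : Prop :=
  IsBorelOrbit v O ∧ ∀ O' : Set (X K V k l), IsBorelOrbit v O' → WeakLE v O' O → O' = O

end Borel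

end DoubleGrassmannian

/-! Write F_j for `coordFlag v j`. Positions are counted from 0, so `lo i` and `hi i` are i and i +
1, and F_{i+1} is the only member of the flag that P_i moves. For a subspace L, the set `jumps v L`
of positions where dim (L ∩ F_j) grows is B-invariant and has dim L elements. The minimal orbits in
X_d turn out to be the sets `cell` of pairs (U, W) with jump sets (A, A') such that A ∩ A' is the
first d positions and A ∪ A' the first k + l - d (`IsAdapted`). Such a pair amounts to choosing k -
d of the k + l - 2d positions in between, which gives the binomial coefficient.

Minimal orbits are adapted. Suppose w lies in F_{i+2} but not in F_{i+1}, φ kills F_i but not the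
basis vector at `lo i`, and each of U and W either contains w or is killed by φ. The invertible maps
y ↦ y + rφ(y)w then fix (U, W) and sweep F_{i+1} through a dense part of the projective line of its
possible positions. Hence the B-orbit of x is dense in P_i x, and any other B-orbit in P_i x lies
strictly below it in the weak order (`not_isMinimalOrbit`). Applied to U ∩ W, to U + W, and to U and
W separately, this forces three jump sets to be initial segments (`isAdapted_of_isMinimalOrbit`).
That P_i Z is closed for closed B-stable Z, needed to compute the weak order, comes from
completeness of the projective line in the elementary form `exists_eliminant`.

Adapted cells are minimal. An adapted cell is one B-orbit, because both subspaces can be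
straightened to coordinate subspaces simultaneously (`cell_eq_orbit`). It is closed in X_d, because
there the Schubert inequalities for U and W have to be equalities (`mem_cell_of_mem_closedCell`). An
orbit below it in the weak order has the same dim (U ∩ W), by semicontinuity in one direction and by
GL(V)-invariance in the other, so it lies in X_d and hence in the cell (`isMinimalOrbit_cell`).

For the dimension, reduced echelon forms identify the cell homeomorphically with an affine space
having one coordinate for each pair in (A \ A') × (A' \ A) (`isEmbedding_cellParam`,
`range_cellParam`). The Krull dimension of a polynomial ring finishes the computation. -/

namespace DoubleGrassmannian

/-! ### Polynomial functions on a vector space and semicontinuity of rank -/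

section PolynomialFunctions

variable (K E : Type*) [Field K] [AddCommGroup E] [Module K E]

/-- The algebra of polynomial functions on the vector space `E`. -/
def polyFun : Subalgebra K (E → K) :=
  Algebra.adjoin K (Set.range fun φ : Module.Dual K E => (φ : E → K))

variable {K E}

theorem mem_polyFun_iff {f : E → K} :
    f ∈ polyFun K E ↔ ∃ p : MvPolynomial (Module.Dual K E) K,
      ∀ x, MvPolynomial.eval (fun φ : Module.Dual K E => φ x) p = f x := by
  have key : ∀ (p : MvPolynomial (Module.Dual K E) K) (x : E),
      MvPolynomial.aeval (fun φ : Module.Dual K E => (φ : E → K)) p x =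
        MvPolynomial.eval (fun φ : Module.Dual K E => φ x) p := by
    intro p x
    induction p using MvPolynomial.induction_on with
    | C a => simp
    | add p q hp hq => simp [hp, hq]
    | mul_X p φ hp => simp [hp]
  rw [polyFun, Algebra.adjoin_range_eq_range_aeval, AlgHom.mem_range]
  constructor
  · rintro ⟨p, rfl⟩
    exact ⟨p, fun x => (key p x).symm⟩
  · rintro ⟨p, hp⟩
    exact ⟨p, funext fun x => (key p x).trans (hp x)⟩

theorem dual_mem_polyFun (φ : Module.Dual K E) : (φ : E → K) ∈ polyFun K E :=
  Algebra.subset_adjoin ⟨φ, rfl⟩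

theorem const_mem_polyFun (c : K) : (fun _ : E => c) ∈ polyFun K E :=
  (polyFun K E).algebraMap_mem c

theorem det_mem_polyFun {ι : Type*} [Fintype ι] [DecidableEq ι] {A : E → Matrix ι ι K}
    (hA : ∀ i j, (fun x => A x i j) ∈ polyFun K E) : (fun x => (A x).det) ∈ polyFun K E := by
  have : (fun x => (A x).det) =
      ∑ σ : Equiv.Perm ι, (fun _ : E => ((Equiv.Perm.sign σ : ℤ) : K)) *
        ∏ i, fun x => A x (σ i) i := by
    ext x
    simp [Matrix.det_apply', Finset.sum_apply, Finset.prod_apply]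
  rw [this]
  exact sum_mem fun σ _ => mul_mem (const_mem_polyFun _) (prod_mem fun i _ => hA _ _)

/-- Polynomial functions are stable under polynomial substitutions. -/
theorem comp_mem_polyFun {E' : Type*} [AddCommGroup E'] [Module K E'] {Φ : E' → E}
    (hΦ : ∀ φ : Module.Dual K E, (fun x => φ (Φ x)) ∈ polyFun K E') {f : E → K}
    (hf : f ∈ polyFun K E) : (fun x => f (Φ x)) ∈ polyFun K E' := by
  induction hf using Algebra.adjoin_induction with
  | mem f h =>
    obtain ⟨φ, rfl⟩ := h
    exact hΦ φ
  | algebraMap r => exact const_mem_polyFun r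
  | add f g _ _ hf hg => exact add_mem hf hg
  | mul f g _ _ hf hg => exact mul_mem hf hg

theorem comp_linear_mem_polyFun {E' : Type*} [AddCommGroup E'] [Module K E'] (Φ : E' →ₗ[K] E)
    {f : E → K} (hf : f ∈ polyFun K E) : (fun x => f (Φ x)) ∈ polyFun K E' :=
  comp_mem_polyFun (fun φ => dual_mem_polyFun (φ.comp Φ)) hf

/-- Turns closedness into separating one point at a time by one polynomial function; all later
closedness proofs exhibit such a function. -/
theorem isClosed_zariskiAffine_iff {Z : Set E} :
    @IsClosed E (zariskiAffine K E) Z ↔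
      ∀ x ∉ Z, ∃ f ∈ polyFun K E, f x ≠ 0 ∧ ∀ y ∈ Z, f y = 0 := by
  have h0 : @IsClosed E (zariskiAffine K E) Z ↔ ∃ S, Z = zeros K E S := by
    rw [← @isOpen_compl_iff _ _ (zariskiAffine K E)]
    change Zᶜᶜ ∈ {Z | ∃ S, Z = zeros K E S} ↔ _
    rw [compl_compl]
    rfl
  rw [h0]
  constructor
  · rintro ⟨S, rfl⟩ x hx
    simp only [zeros, Set.mem_ofPred_eq, not_forall] at hx
    obtain ⟨p, hp, hpx⟩ := hx
    exact ⟨_, mem_polyFun_iff.2 ⟨p, fun _ => rfl⟩, hpx, fun y hy => hy p hp⟩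
  · intro h
    refine ⟨{p | ∀ y ∈ Z, MvPolynomial.eval (fun φ : Module.Dual K E => φ y) p = 0}, ?_⟩
    ext x
    refine ⟨fun hx p hp => hp x hx, fun hx => ?_⟩
    by_contra hxZ
    obtain ⟨f, hf, hfx, hfZ⟩ := h x hxZ
    obtain ⟨p, hp⟩ := mem_polyFun_iff.1 hf
    exact hfx ((hp x).symm.trans (hx p fun y hy => (hp y).trans (hfZ y hy)))

/-- The rank of a family of vectors that depends linearly on a parameter is lower
semicontinuous. -/
theorem exists_polyFun_finrank_span_le {V' ι : Type*} [AddCommGroup V'] [Module K V']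
    [Finite ι] (Φ : E →ₗ[K] (ι → V')) (x₀ : E) :
    ∃ f ∈ polyFun K E, f x₀ ≠ 0 ∧ ∀ x, f x ≠ 0 →
      Module.finrank K (Submodule.span K (Set.range (Φ x₀))) ≤
        Module.finrank K (Submodule.span K (Set.range (Φ x))) := by
  classical
  obtain ⟨κ, a, ha, hspan, hli⟩ := exists_linearIndependent' K (Φ x₀)
  have : Finite κ := Finite.of_injective a ha
  have := Fintype.ofFinite κ
  have hfin : ∀ x, Module.Finite K (Submodule.span K (Set.range (Φ x))) := fun x =>
    FiniteDimensional.span_of_finite K (Set.finite_range _)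
  let b := Module.Basis.extend hli.linearIndepOn_id
  obtain ⟨ψ, hψ⟩ : ∃ ψ : κ → Module.Dual K V',
      ∀ i j, ψ j (Φ x₀ (a i)) = if i = j then 1 else 0 := by
    let e : κ → (hli.linearIndepOn_id.extend (Set.subset_univ _)) := fun i =>
      ⟨(Φ x₀ ∘ a) i, hli.linearIndepOn_id.subset_extend _ ⟨i, rfl⟩⟩
    have he : Function.Injective e := fun i j h =>
      hli.injective (congrArg Subtype.val h)
    have hb : ∀ i, Φ x₀ (a i) = b (e i) := fun i => by
      rw [Module.Basis.extend_apply_self]; rfl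
    refine ⟨fun j => b.coord (e j), fun i j => ?_⟩
    rw [hb, Module.Basis.coord_apply, Module.Basis.repr_self, Finsupp.single_apply]
    simp only [he.eq_iff]
  -- The functionals ψ are dual to a maximal independent subfamily at `x₀`, so this minor is 1 at
  -- `x₀`; wherever it is nonzero the same subfamily stays independent.
  refine ⟨fun x => (Matrix.of fun i j => ψ j (Φ x (a i))).det, ?_, ?_, ?_⟩
  · refine det_mem_polyFun fun i j => ?_
    exact dual_mem_polyFun ((ψ j).comp ((LinearMap.proj (a i)).comp Φ))
  · have : (Matrix.of fun i j => ψ j (Φ x₀ (a i))) = (1 : Matrix κ κ K) := by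
      ext i j
      simp [hψ, Matrix.one_apply]
    simp [this]
  · intro x hx
    have hrow := Matrix.linearIndependent_rows_of_det_ne_zero hx
    have hli' : LinearIndependent K (Φ x ∘ a) :=
      LinearIndependent.of_comp (LinearMap.pi ψ) hrow
    rw [← hspan, finrank_span_eq_card hli, ← finrank_span_eq_card hli']
    have := hfin x
    exact Submodule.finrank_mono (Submodule.span_mono (Set.range_comp_subset_range a (Φ x)))

end PolynomialFunctions

/-! ### The Zariski topology on pairs of subspaces -/

section Topology

variable {K V : Type*} [Field K] [AddCommGroup V] [Module K V] {k l : ℕ}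

/-- The separation criterion pulled back to frames. The function need not descend to X: it only has
to vanish on all frames over `T`. -/
theorem isClosed_X_iff {T : Set (X K V k l)} :
    IsClosed T ↔ ∀ p : Frames K V k l, p.span ∉ T →
      ∃ f ∈ polyFun K ((Fin k → V) × (Fin l → V)), f (p.u, p.w) ≠ 0 ∧
        ∀ q : Frames K V k l, q.span ∈ T → f (q.u, q.w) = 0 := by
  let τ := zariskiAffine K ((Fin k → V) × (Fin l → V))
  have h1 : IsClosed T ↔ IsClosed (Frames.span (K := K) (V := V) (k := k) (l := l) ⁻¹' T) :=
    isClosed_coinduced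
  rw [h1, @isClosed_induced_iff _ _ τ]
  constructor
  · rintro ⟨Z, hZ, hZT⟩ p hp
    have hmem : ∀ q : Frames K V k l, (q.u, q.w) ∈ Z ↔ q.span ∈ T := fun q => by
      change q ∈ (fun p : Frames K V k l => (p.u, p.w)) ⁻¹' Z ↔ _
      rw [hZT]; rfl
    obtain ⟨f, hf, hfp, hfZ⟩ := isClosed_zariskiAffine_iff.1 hZ _ (mt (hmem p).1 hp)
    exact ⟨f, hf, hfp, fun q hq => hfZ _ ((hmem q).2 hq)⟩
  · intro h
    refine ⟨{y : (Fin k → V) × (Fin l → V) | ∀ f ∈ polyFun K ((Fin k → V) × (Fin l → V)),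
      (∀ q : Frames K V k l, q.span ∈ T → f (q.u, q.w) = 0) → f y = 0}, ?_, ?_⟩
    · refine isClosed_zariskiAffine_iff.2 fun y hy => ?_
      simp only [Set.mem_ofPred_eq, not_forall] at hy
      obtain ⟨f, hf, hfT, hfy⟩ := hy
      exact ⟨f, hf, hfy, fun z hz => hz f hf hfT⟩
    · ext q
      refine ⟨fun hq => ?_, fun hq f _ hf => hf q hq⟩
      by_contra hqT
      obtain ⟨f, hf, hfq, hfT⟩ := h q hqT
      exact hfq (hq f hf hfT)

@[simp] theorem smul_space {m : ℕ} (g : V ≃ₗ[K] V) (U : Gr K V m) :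
    (g • U).space = U.space.map (g : V →ₗ[K] V) := rfl

@[simp] theorem smul_U (g : V ≃ₗ[K] V) (x : X K V k l) : (g • x).U = g • x.U := rfl

@[simp] theorem smul_W (g : V ≃ₗ[K] V) (x : X K V k l) : (g • x).W = g • x.W := rfl

/-- The image of a pair of frames under a linear automorphism. -/
def Frames.map (g : V ≃ₗ[K] V) (p : Frames K V k l) : Frames K V k l where
  u := fun a => g (p.u a)
  w := fun a => g (p.w a)
  linearIndependent_u := p.linearIndependent_u.map' (g : V →ₗ[K] V) g.ker
  linearIndependent_w := p.linearIndependent_w.map' (g : V →ₗ[K] V) g.ker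

theorem Frames.span_map (g : V ≃ₗ[K] V) (p : Frames K V k l) : (p.map g).span = g • p.span := by
  refine X.ext (Gr.ext ?_) (Gr.ext ?_)
  · change Submodule.span K (Set.range fun a => g (p.u a)) = (Submodule.span K _).map _
    rw [Submodule.map_span, ← Set.range_comp]
    rfl
  · change Submodule.span K (Set.range fun a => g (p.w a)) = (Submodule.span K _).map _
    rw [Submodule.map_span, ← Set.range_comp]
    rfl

/-- A linear endomorphism of `V` acting on pairs of tuples. -/
def prodMap (k l : ℕ) (f : V →ₗ[K] V) :
    ((Fin k → V) × (Fin l → V)) →ₗ[K] ((Fin k → V) × (Fin l → V)) :=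
  (f.compLeft (Fin k)).prodMap (f.compLeft (Fin l))

instance : ContinuousConstSMul (V ≃ₗ[K] V) (X K V k l) where
  continuous_const_smul g := by
    refine continuous_iff_isClosed.2 fun T hT => isClosed_X_iff.2 fun p hp => ?_
    rw [Set.mem_preimage, ← Frames.span_map] at hp
    obtain ⟨f, hf, hfp, hfT⟩ := isClosed_X_iff.1 hT _ hp
    refine ⟨_, comp_linear_mem_polyFun (prodMap k l (g : V →ₗ[K] V)) hf, hfp, fun q hq => ?_⟩
    rw [Set.mem_preimage, ← Frames.span_map] at hq
    exact hfT _ hq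

theorem Frames.exists_span_eq [Module.Finite K V] (x : X K V k l) :
    ∃ p : Frames K V k l, p.span = x := by
  let b := Module.finBasisOfFinrankEq K x.U.space x.U.finrank_space
  let c := Module.finBasisOfFinrankEq K x.W.space x.W.finrank_space
  refine ⟨⟨fun a => b a, fun a => c a, ?_, ?_⟩, ?_⟩
  · exact b.linearIndependent.map' x.U.space.subtype (Submodule.ker_subtype _)
  · exact c.linearIndependent.map' x.W.space.subtype (Submodule.ker_subtype _)
  · refine X.ext (Gr.ext ?_) (Gr.ext ?_)
    · change Submodule.span K (Set.range (x.U.space.subtype ∘ b)) = _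
      rw [Set.range_comp, ← Submodule.map_span, b.span_eq, Submodule.map_top,
        Submodule.range_subtype]
    · change Submodule.span K (Set.range (x.W.space.subtype ∘ c)) = _
      rw [Set.range_comp, ← Submodule.map_span, c.span_eq, Submodule.map_top,
        Submodule.range_subtype]

theorem finrank_map_mkQ_add [Module.Finite K V] (U F : Submodule K V) :
    Module.finrank K (U.map F.mkQ) + Module.finrank K (U ⊓ F : Submodule K V) =
      Module.finrank K U := by
  have h := LinearMap.finrank_range_add_finrank_ker (F.mkQ.domRestrict U)
  rw [LinearMap.range_domRestrict, LinearMap.ker_domRestrict, Submodule.ker_mkQ] at h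
  rw [← h, ← Submodule.map_comap_subtype, Submodule.finrank_map_subtype_eq]

/-- The dimension of U ∩ F is k minus the rank of a frame of U modulo F, and rank is lower
semicontinuous. -/
theorem isClosed_le_finrank_inf_left [Module.Finite K V] (F : Submodule K V) (r : ℕ) :
    IsClosed {x : X K V k l | r ≤ Module.finrank K (x.U.space ⊓ F : Submodule K V)} := by
  refine isClosed_X_iff.2 fun p hp => ?_
  let Φ : ((Fin k → V) × (Fin l → V)) →ₗ[K] (Fin k → V ⧸ F) :=
    (F.mkQ.compLeft (Fin k)).comp (LinearMap.fst K _ _)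
  have hΦ : ∀ q : Frames K V k l,
      Submodule.span K (Set.range (Φ (q.u, q.w))) = q.span.U.space.map F.mkQ := fun q => by
    change _ = (Submodule.span K (Set.range q.u)).map F.mkQ
    rw [Submodule.map_span, ← Set.range_comp]
    rfl
  obtain ⟨f, hf, hfp, hfq⟩ := exists_polyFun_finrank_span_le Φ (p.u, p.w)
  refine ⟨f, hf, hfp, fun q hq => ?_⟩
  by_contra hne
  have h := hfq _ hne
  rw [hΦ, hΦ] at h
  have h1 := finrank_map_mkQ_add p.span.U.space F
  have h2 := finrank_map_mkQ_add q.span.U.space F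
  rw [Gr.finrank_space] at h1 h2
  simp only [Set.mem_ofPred_eq] at hp hq
  omega

theorem isClosed_le_finrank_inf_right [Module.Finite K V] (F : Submodule K V) (r : ℕ) :
    IsClosed {x : X K V k l | r ≤ Module.finrank K (x.W.space ⊓ F : Submodule K V)} := by
  refine isClosed_X_iff.2 fun p hp => ?_
  let Φ : ((Fin k → V) × (Fin l → V)) →ₗ[K] (Fin l → V ⧸ F) :=
    (F.mkQ.compLeft (Fin l)).comp (LinearMap.snd K _ _)
  have hΦ : ∀ q : Frames K V k l,
      Submodule.span K (Set.range (Φ (q.u, q.w))) = q.span.W.space.map F.mkQ := fun q => by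
    change _ = (Submodule.span K (Set.range q.w)).map F.mkQ
    rw [Submodule.map_span, ← Set.range_comp]
    rfl
  obtain ⟨f, hf, hfp, hfq⟩ := exists_polyFun_finrank_span_le Φ (p.u, p.w)
  refine ⟨f, hf, hfp, fun q hq => ?_⟩
  by_contra hne
  have h := hfq _ hne
  rw [hΦ, hΦ] at h
  have h1 := finrank_map_mkQ_add p.span.W.space F
  have h2 := finrank_map_mkQ_add q.span.W.space F
  rw [Gr.finrank_space] at h1 h2
  simp only [Set.mem_ofPred_eq] at hp hq
  omega

/-- Here dim (U ∩ W) is k + l minus the rank of the two frames put together. -/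
theorem isClosed_le_finrank_inf [Module.Finite K V] (r : ℕ) :
    IsClosed {x : X K V k l |
      r ≤ Module.finrank K (x.U.space ⊓ x.W.space : Submodule K V)} := by
  refine isClosed_X_iff.2 fun p hp => ?_
  let Φ : ((Fin k → V) × (Fin l → V)) →ₗ[K] (Fin k ⊕ Fin l → V) :=
    (LinearEquiv.sumArrowLequivProdArrow (Fin k) (Fin l) K V).symm
  have hΦ : ∀ q : Frames K V k l, Submodule.span K (Set.range (Φ (q.u, q.w))) =
      q.span.U.space ⊔ q.span.W.space := fun q => by
    change _ = Submodule.span K (Set.range q.u) ⊔ Submodule.span K (Set.range q.w)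
    rw [← Submodule.span_union, ← Set.Sum.elim_range]
    congr 2
  obtain ⟨f, hf, hfp, hfq⟩ := exists_polyFun_finrank_span_le Φ (p.u, p.w)
  refine ⟨f, hf, hfp, fun q hq => ?_⟩
  by_contra hne
  have h := hfq _ hne
  rw [hΦ, hΦ] at h
  have h1 := Submodule.finrank_sup_add_finrank_inf_eq p.span.U.space p.span.W.space
  have h2 := Submodule.finrank_sup_add_finrank_inf_eq q.span.U.space q.span.W.space
  rw [Gr.finrank_space, Gr.finrank_space] at h1 h2
  simp only [Set.mem_ofPred_eq] at hp hq
  omega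

end Topology

end DoubleGrassmannian

namespace DoubleGrassmannian

/-! ### Elimination over the projective line -/

section Elimination

open Polynomial

/-- Elimination of a parameter that runs over the projective line: if two families of polynomials
`S` and `S'` have no common zero at one specialization of the coefficients, then some function of
the coefficients vanishes at all specializations with a common zero, but not at this one. -/
theorem exists_eliminant {R K Q : Type*} [CommRing R] [Field K] [IsAlgClosed K]
    (ev : Q → R →+* K) (hev : ∀ q, Function.Surjective (ev q)) (S S' : Set R[X]) (q₀ : Q)
    (h₀ : ∀ t, ∃ P ∈ S, (P.map (ev q₀)).eval t ≠ 0)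
    (h₀' : ∀ t, ∃ P ∈ S', (P.map (ev q₀)).eval t ≠ 0) :
    ∃ r : R, ev q₀ r ≠ 0 ∧ ∀ q,
      ((∀ P ∈ S, (P.map (ev q)).eval 0 = 0) ∨ (∀ P ∈ S', (P.map (ev q)).eval 0 = 0) ∨
        ∃ t ≠ 0, (∀ P ∈ S, (P.map (ev q)).eval t = 0) ∧
          ∀ P ∈ S', (P.map (ev q)).eval t⁻¹ = 0) → ev q r = 0 := by
  -- Without a common zero at `q₀`, the specialized polynomials generate the unit ideal of `K[X]`.
  -- Lifting 1 replaces the whole family by a single member of its ideal that specializes to 1.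
  have key : ∀ S : Set R[X], (∀ t, ∃ P ∈ S, (P.map (ev q₀)).eval t ≠ 0) →
      ∃ F : R[X], F.map (ev q₀) = 1 ∧
        ∀ q t, (∀ P ∈ S, (P.map (ev q)).eval t = 0) → (F.map (ev q)).eval t = 0 := by
    intro S hS
    have htop : (Ideal.span S).map (mapRingHom (ev q₀)) = ⊤ := by
      by_contra hne
      obtain ⟨M, hM, hle⟩ := Ideal.exists_le_maximal _ hne
      obtain ⟨g, hg⟩ := (inferInstance : IsPrincipalIdealRing K[X]).principal M
      have hdeg : g.degree ≠ 0 := by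
        intro h
        refine hM.ne_top ?_
        rw [hg, ← Ideal.span, Ideal.span_singleton_eq_top]
        exact isUnit_iff_degree_eq_zero.2 h
      obtain ⟨t, ht⟩ := IsAlgClosed.exists_root g hdeg
      obtain ⟨P, hP, hPt⟩ := hS t
      have hPM : P.map (ev q₀) ∈ M :=
        hle (Ideal.mem_map_of_mem (mapRingHom (ev q₀)) (Ideal.subset_span hP))
      rw [hg] at hPM
      obtain ⟨c, hc⟩ := Submodule.mem_span_singleton.1 hPM
      refine hPt ?_
      rw [← hc, smul_eq_mul, eval_mul, ht.eq_zero, mul_zero]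
    have h1 : (1 : K[X]) ∈ (Ideal.span S).map (mapRingHom (ev q₀)) := htop ▸ Submodule.mem_top
    obtain ⟨F, hF, hF1⟩ := (Ideal.mem_map_iff_of_surjective _
      (map_surjective (ev q₀) (hev q₀))).1 h1
    refine ⟨F, hF1, fun q t hqt => ?_⟩
    have hle : Ideal.span S ≤ RingHom.ker ((evalRingHom t).comp (mapRingHom (ev q))) :=
      Ideal.span_le.2 fun P hP => hqt P hP
    exact hle hF
  obtain ⟨F, hF1, hF⟩ := key S h₀
  obtain ⟨G, hG1, hG⟩ := key S' h₀'
  let N := F.natDegree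
  let M := G.natDegree
  -- A Sylvester-type matrix: M + 1 shifts of F and N shifts of the reversal of G. At `q₀` the
  -- reversal of G becomes X^M, so row j becomes X^j and the matrix becomes the identity.
  let row : Fin (M + N + 1) → R[X] := fun j =>
    if (j : ℕ) ≤ M then Polynomial.X ^ (j : ℕ) * F
    else Polynomial.X ^ ((j : ℕ) - M) * G.reflect M
  have hrow_deg : ∀ j, (row j).natDegree < M + N + 1 := by
    intro j
    have hj := j.2
    simp only [row]
    split_ifs with h
    · refine lt_of_le_of_lt natDegree_mul_le ?_
      have := natDegree_X_pow_le (R := R) (j : ℕ)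
      omega
    · refine lt_of_le_of_lt natDegree_mul_le ?_
      have h1 := natDegree_X_pow_le (R := R) ((j : ℕ) - M)
      have h2 : (G.reflect M).natDegree ≤ M := by
        refine (natDegree_reflect_le).trans ?_
        simp [M]
      omega
  let A : Matrix (Fin (M + N + 1)) (Fin (M + N + 1)) R := Matrix.of fun j c => (row j).coeff c
  have hrow_one : ∀ j, (row j).map (ev q₀) = Polynomial.X ^ (j : ℕ) := by
    intro j
    simp only [row]
    split_ifs with h
    · simp [Polynomial.map_mul, hF1]
    · have : (G.reflect M).map (ev q₀) = Polynomial.X ^ M := by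
        rw [← reflect_map, hG1, ← C_1, reflect_C, C_1, one_mul]
      rw [Polynomial.map_mul, this, Polynomial.map_pow, map_X, ← pow_add]
      congr 1
      omega
  -- The constant terms detect the zeros at 0 and at infinity. A zero t ≠ 0 gives the kernel vector
  -- (1, t, t², …), which kills the determinant.
  refine ⟨F.coeff 0 * G.coeff 0 * A.det, ?_, ?_⟩
  · have hFc : ev q₀ (F.coeff 0) = 1 := by rw [← coeff_map, hF1, coeff_one_zero]
    have hGc : ev q₀ (G.coeff 0) = 1 := by rw [← coeff_map, hG1, coeff_one_zero]
    have hA : A.map (ev q₀) = 1 := by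
      ext j c
      change ev q₀ ((row j).coeff c) = _
      rw [← coeff_map, hrow_one, coeff_X_pow, Matrix.one_apply]
      simp only [Fin.ext_iff, eq_comm]
    have hdet : ev q₀ A.det = 1 := by
      rw [RingHom.map_det, RingHom.mapMatrix_apply, hA, Matrix.det_one]
    simp [hFc, hGc, hdet]
  · rintro q (h | h | ⟨t, ht, h, h'⟩)
    · have := hF q 0 h
      rw [← coeff_zero_eq_eval_zero, coeff_map] at this
      simp [this]
    · have := hG q 0 h
      rw [← coeff_zero_eq_eval_zero, coeff_map] at this
      simp [this]
    · have hFt := hF q t h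
      have hGt := hG q t⁻¹ h'
      have hrow : ∀ j, ((row j).map (ev q)).eval t = 0 := by
        intro j
        simp only [row]
        split_ifs with hj
        · simp [Polynomial.map_mul, hFt]
        · have h1 : ((G.map (ev q)).reflect M).eval t = 0 := by
            let : Invertible t⁻¹ := invertibleOfNonzero (inv_ne_zero ht)
            have := eval₂_reflect_eq_zero_iff (RingHom.id K) t⁻¹ M (G.map (ev q))
              natDegree_map_le
            rw [invOf_eq_inv, inv_inv] at this
            exact this.2 hGt
          rw [Polynomial.map_mul, eval_mul, ← reflect_map, h1, mul_zero]
      have hdet : (A.map (ev q)).det = 0 := by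
        refine Matrix.exists_mulVec_eq_zero_iff.1 ⟨fun c => t ^ (c : ℕ), ?_, ?_⟩
        · intro h0
          have := congrFun h0 0
          simp at this
        · ext j
          have := hrow j
          rw [eval_eq_sum_range' (lt_of_le_of_lt natDegree_map_le (hrow_deg j)),
            Finset.sum_range] at this
          simpa [Matrix.mulVec, dotProduct, A] using this
      have : ev q A.det = 0 := by
        rw [RingHom.map_det, RingHom.mapMatrix_apply, hdet]
      simp [this]

variable {K E : Type*} [Field K] [AddCommGroup E] [Module K E]

/-- Evaluation of polynomial functions at a point. -/
def evalAt (q : E) : polyFun K E →+* K :=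
  (Pi.evalRingHom (fun _ : E => K) q).comp (polyFun K E).val.toRingHom

theorem evalAt_apply (q : E) (f : polyFun K E) : evalAt q f = (f : E → K) q := rfl

theorem evalAt_surjective (q : E) : Function.Surjective (evalAt (K := K) q) := fun c =>
  ⟨⟨fun _ => c, const_mem_polyFun c⟩, rfl⟩

/-- A polynomial function depends polynomially on the parameter of a line. -/
theorem exists_polynomial_eval_line {E' : Type*} [AddCommGroup E'] [Module K E'] {f : E' → K}
    (hf : f ∈ polyFun K E') (L₀ L₁ : E →ₗ[K] E') :
    ∃ P : (polyFun K E)[X], ∀ t q, f (L₀ q + t • L₁ q) = (P.map (evalAt q)).eval t := by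
  induction hf using Algebra.adjoin_induction with
  | mem f h =>
    obtain ⟨φ, rfl⟩ := h
    refine ⟨C ⟨_, dual_mem_polyFun (φ.comp L₀)⟩ + C ⟨_, dual_mem_polyFun (φ.comp L₁)⟩ * Polynomial.X,
      fun t q => ?_⟩
    simp [evalAt_apply, mul_comm t]
  | algebraMap r =>
    exact ⟨C ⟨fun _ => r, const_mem_polyFun r⟩, fun t q => by simp [evalAt_apply]⟩
  | add f g _ _ hf hg =>
    obtain ⟨P, hP⟩ := hf
    obtain ⟨P', hP'⟩ := hg
    exact ⟨P + P', fun t q => by simp [hP, hP']⟩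
  | mul f g _ _ hf hg =>
    obtain ⟨P, hP⟩ := hf
    obtain ⟨P', hP'⟩ := hg
    exact ⟨P * P', fun t q => by simp [hP, hP', Polynomial.map_mul]⟩

end Elimination

end DoubleGrassmannian

namespace DoubleGrassmannian

/-! ### Jumps of a subspace along the flag, and triangular families of vectors -/

section Jumps

variable {K V : Type*} [Field K] [AddCommGroup V] [Module K V] {n : ℕ}
  (v : Module.Basis (Fin n) K V)

/-- The subspace of the flag spanned by the first `j` basis vectors. -/
def coordFlag (j : ℕ) : Submodule K V where
  carrier := {x | ∀ a : Fin n, j ≤ a → v.repr x a = 0}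
  zero_mem' := by simp
  add_mem' := fun {x y} hx hy a ha => by simp [hx a ha, hy a ha]
  smul_mem' := fun c x hx a ha => by simp [hx a ha]

/-- The last nonzero coordinate of `x` is the `a`-th one. -/
def Lead (x : V) (a : Fin n) : Prop :=
  v.repr x a ≠ 0 ∧ ∀ b, a < b → v.repr x b = 0

variable {v}

theorem exists_lead {x : V} (hx : x ≠ 0) : ∃ a, Lead v x a := by
  have hne : (v.repr x).support.Nonempty := by
    rw [Finsupp.support_nonempty_iff]
    simpa using hx
  refine ⟨(v.repr x).support.max' hne, ?_, fun b hb => ?_⟩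
  · exact Finsupp.mem_support_iff.1 (Finset.max'_mem _ hne)
  · by_contra h
    exact absurd (Finset.le_max' _ b (Finsupp.mem_support_iff.2 h)) (not_le.2 hb)

theorem Lead.mem_coordFlag_iff {x : V} {a : Fin n} (h : Lead v x a) {j : ℕ} :
    x ∈ coordFlag v j ↔ (a : ℕ) < j := by
  constructor
  · intro hx
    by_contra hlt
    exact h.1 (hx a (not_lt.1 hlt))
  · intro hlt b hb
    exact h.2 b (Fin.lt_def.2 (by omega))

theorem Lead.ne_zero {x : V} {a : Fin n} (h : Lead v x a) : x ≠ 0 := by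
  rintro rfl
  exact h.1 (by simp)

theorem lead_basis (a : Fin n) : Lead v (v a) a :=
  ⟨by simp, fun b hb => by simp [hb.ne]⟩

theorem coordFlag_mono {i j : ℕ} (h : i ≤ j) : coordFlag v i ≤ coordFlag v j :=
  fun _ hx a ha => hx a (h.trans ha)

theorem basis_mem_coordFlag_iff {a : Fin n} {j : ℕ} : v a ∈ coordFlag v j ↔ (a : ℕ) < j :=
  (lead_basis a).mem_coordFlag_iff

theorem coordFlag_eq_top {j : ℕ} (hj : n ≤ j) : coordFlag v j = ⊤ :=
  eq_top_iff.2 fun _ _ a ha => absurd a.2 (by omega)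

theorem flag_eq_coordFlag (j : Fin (n + 1)) : v.flag j = coordFlag v j := by
  apply le_antisymm
  · rw [Module.Basis.flag_le_iff]
    intro i hi
    exact basis_mem_coordFlag_iff.2 hi
  · intro x hx
    rw [← v.sum_repr x]
    refine Submodule.sum_mem _ fun a _ => ?_
    by_cases ha : (a : ℕ) < j
    · exact Submodule.smul_mem _ _ (v.self_mem_flag ha)
    · rw [hx a (not_lt.1 ha), zero_smul]
      exact Submodule.zero_mem _

/-- Leading terms at distinct positions cannot cancel, so the highest one that occurs survives. -/
theorem lead_sum {ι : Type*} [Fintype ι] {y : ι → V} {f : ι → Fin n} (hf : Function.Injective f)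
    (hy : ∀ i, Lead v (y i) (f i)) {c : ι → K} {i₀ : ι} (h0 : c i₀ ≠ 0)
    (hc : ∀ i, c i ≠ 0 → f i ≤ f i₀) : Lead v (∑ i, c i • y i) (f i₀) := by
  have hrepr : ∀ b, v.repr (∑ i, c i • y i) b = ∑ i, c i * v.repr (y i) b := by
    intro b
    simp [Finsupp.finsetSum_apply]
  constructor
  · rw [hrepr, Finset.sum_eq_single i₀]
    · exact mul_ne_zero h0 (hy i₀).1
    · intro i _ hi
      by_cases hci : c i = 0
      · rw [hci, zero_mul]
      · rw [(hy i).2 _ (lt_of_le_of_ne (hc i hci) fun h => hi (hf h)), mul_zero]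
    · simp
  · intro b hb
    rw [hrepr]
    refine Finset.sum_eq_zero fun i _ => ?_
    by_cases hci : c i = 0
    · rw [hci, zero_mul]
    · rw [(hy i).2 _ ((hc i hci).trans_lt hb), mul_zero]

theorem linearIndependent_of_lead {ι : Type*} [Finite ι] {y : ι → V} {f : ι → Fin n}
    (hf : Function.Injective f) (hy : ∀ i, Lead v (y i) (f i)) : LinearIndependent K y := by
  classical
  have := Fintype.ofFinite ι
  rw [Fintype.linearIndependent_iff]
  intro c hc
  by_contra! hne
  obtain ⟨i₁, hi₁⟩ := hne
  obtain ⟨i₀, hi₀, hmax⟩ := Finset.exists_max_image (Finset.univ.filter fun i => c i ≠ 0) f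
    ⟨i₁, by simp [hi₁]⟩
  refine (lead_sum hf hy (Finset.mem_filter.1 hi₀).2 fun i hi => hmax i ?_).ne_zero hc
  simp [hi]

theorem Lead.map {g : V →ₗ[K] V} (hg : ∀ a, Lead v (g (v a)) a) {x : V} {a : Fin n}
    (h : Lead v x a) : Lead v (g x) a := by
  have hx : g x = ∑ b, v.repr x b • g (v b) := by
    conv_lhs => rw [← v.sum_repr x]
    rw [map_sum]
    simp_rw [map_smul]
  rw [hx]
  refine lead_sum (f := id) Function.injective_id hg h.1 fun b hb => ?_
  by_contra hlt
  exact hb (h.2 b (not_le.1 hlt))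

theorem mem_stabilizer_iff_forall [Module.Finite K V] {g : V ≃ₗ[K] V} {S : Submodule K V} :
    g ∈ MulAction.stabilizer (V ≃ₗ[K] V) S ↔ ∀ x ∈ S, g x ∈ S := by
  rw [MulAction.mem_stabilizer_iff]
  constructor
  · intro h x hx
    rw [← h]
    exact Submodule.smul_mem_pointwise_smul x g S hx
  · intro h
    have hmap : g • S = S.map (g : V →ₗ[K] V) := rfl
    rw [hmap]
    refine Submodule.eq_of_le_of_finrank_eq ?_ (LinearEquiv.finrank_map_eq g S)
    rintro _ ⟨x, hx, rfl⟩
    exact h x hx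

theorem mem_borelSubgroup_iff {g : V ≃ₗ[K] V} :
    g ∈ borelSubgroup v ↔ ∀ j : ℕ, ∀ x ∈ coordFlag v j, g x ∈ coordFlag v j := by
  have : Module.Finite K V := Module.Finite.of_basis v
  simp only [borelSubgroup, Subgroup.mem_iInf, mem_stabilizer_iff_forall, flag_eq_coordFlag]
  constructor
  · intro h j
    by_cases hj : j < n + 1
    · exact h ⟨j, hj⟩
    · intro x _
      rw [coordFlag_eq_top (by omega)]
      trivial
  · exact fun h j => h j

/-- An element of B maps each F_j onto itself, so it preserves the first member of the flag that
contains a given vector. -/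
theorem Lead.map_borel {g : V ≃ₗ[K] V} (hg : g ∈ borelSubgroup v) {x : V} {a : Fin n}
    (h : Lead v x a) : Lead v (g x) a := by
  rw [mem_borelSubgroup_iff] at hg
  have hx : g x ∈ coordFlag v (a + 1) := hg _ _ (h.mem_coordFlag_iff.2 (Nat.lt_succ_self _))
  refine ⟨fun h0 => ?_, fun b hb => hx b hb⟩
  have hxa : g x ∈ coordFlag v a := by
    intro b hb
    rcases Nat.eq_or_lt_of_le hb with h | h
    · rwa [← Fin.ext h]
    · exact hx b h
  have hfin : Module.Finite K V := Module.Finite.of_basis v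
  have hsurj : (coordFlag v a).map (g : V →ₗ[K] V) = coordFlag v a := by
    refine Submodule.eq_of_le_of_finrank_eq ?_ (LinearEquiv.finrank_map_eq g _)
    rintro _ ⟨y, hy, rfl⟩
    exact hg _ _ hy
  rw [← hsurj] at hxa
  obtain ⟨y, hy, hyx⟩ := hxa
  rw [← g.injective hyx] at h
  exact absurd (h.mem_coordFlag_iff.1 hy) (lt_irrefl _)

theorem mem_borelSubgroup_of_lead {g : V ≃ₗ[K] V} (hg : ∀ a, Lead v (g (v a)) a) :
    g ∈ borelSubgroup v := by
  rw [mem_borelSubgroup_iff]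
  intro j x hx
  by_cases h0 : x = 0
  · rw [h0, map_zero]
    exact Submodule.zero_mem _
  · obtain ⟨a, ha⟩ := exists_lead (v := v) h0
    have := Lead.map (g := (g : V →ₗ[K] V)) hg ha
    exact this.mem_coordFlag_iff.2 (ha.mem_coordFlag_iff.1 hx)

/-- A triangular family of vectors is the image of the basis under an element of `B`. -/
theorem exists_borel_apply_eq {y : Fin n → V} (hy : ∀ a, Lead v (y a) a) :
    ∃ g ∈ borelSubgroup v, ∀ a, g (v a) = y a := by
  have hfin : Module.Finite K V := Module.Finite.of_basis v
  have hli : LinearIndependent K y := linearIndependent_of_lead (f := id) Function.injective_id hy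
  let g₀ : V →ₗ[K] V := v.constr K y
  have hg₀ : ∀ a, g₀ (v a) = y a := fun a => v.constr_basis K y a
  have hinj : Function.Injective g₀ := by
    rw [injective_iff_map_eq_zero]
    intro x hx
    by_contra h0
    obtain ⟨a, ha⟩ := exists_lead (v := v) h0
    exact (Lead.map (fun b => by rw [hg₀]; exact hy b) ha).ne_zero hx
  let g := LinearEquiv.ofInjectiveEndo g₀ hinj
  have hg : ∀ a, g (v a) = y a := hg₀
  exact ⟨g, mem_borelSubgroup_of_lead fun a => by rw [hg]; exact hy a, hg⟩

variable (v)

open Classical in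
/-- The steps of the flag at which the intersection with `L` grows. -/
noncomputable def jumps (L : Submodule K V) : Finset (Fin n) :=
  Finset.univ.filter fun a => ∃ x ∈ L, Lead v x a

variable {v}

theorem mem_jumps {L : Submodule K V} {a : Fin n} : a ∈ jumps v L ↔ ∃ x ∈ L, Lead v x a := by
  simp [jumps]

theorem jumps_mono {L L' : Submodule K V} (h : L ≤ L') : jumps v L ⊆ jumps v L' := fun a ha => by
  obtain ⟨x, hx, hxa⟩ := mem_jumps.1 ha
  exact mem_jumps.2 ⟨x, h hx, hxa⟩

/-- Vectors with distinct leading positions are independent; conversely, a vector of L is determined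
by its coordinates at the jumps, since a nonzero one has its lead there. -/
theorem card_jumps (L : Submodule K V) : (jumps v L).card = Module.finrank K L := by
  have hfin : Module.Finite K V := Module.Finite.of_basis v
  apply le_antisymm
  · choose y hyL hy using fun a : jumps v L => mem_jumps.1 a.2
    have hli : LinearIndependent K (fun a => (⟨y a, hyL a⟩ : L)) := by
      refine LinearIndependent.of_comp L.subtype ?_
      exact linearIndependent_of_lead (f := Subtype.val) Subtype.val_injective hy
    simpa using hli.fintype_card_le_finrank
  · let Φ : L →ₗ[K] (jumps v L → K) := LinearMap.pi fun a => (v.coord a).comp L.subtype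
    have hΦ : Function.Injective Φ := by
      rw [injective_iff_map_eq_zero]
      intro x hx
      by_contra h0
      obtain ⟨a, ha⟩ := exists_lead (v := v) (x := (x : V)) (by simpa using h0)
      exact ha.1 (congrFun hx ⟨a, mem_jumps.2 ⟨x, x.2, ha⟩⟩)
    simpa using LinearMap.finrank_le_finrank_of_injective hΦ

theorem jumps_inf_coordFlag (L : Submodule K V) (j : ℕ) :
    jumps v (L ⊓ coordFlag v j) = (jumps v L).filter fun a : Fin n => (a : ℕ) < j := by
  ext a
  simp only [mem_jumps, Finset.mem_filter, Submodule.mem_inf]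
  constructor
  · rintro ⟨x, ⟨hx, hxj⟩, ha⟩
    exact ⟨⟨x, hx, ha⟩, ha.mem_coordFlag_iff.1 hxj⟩
  · rintro ⟨⟨x, hx, ha⟩, haj⟩
    exact ⟨x, ⟨hx, ha.mem_coordFlag_iff.2 haj⟩, ha⟩

theorem jumps_coordFlag (j : ℕ) :
    jumps v (coordFlag v j) = Finset.univ.filter fun a : Fin n => (a : ℕ) < j := by
  ext a
  simp only [mem_jumps, Finset.mem_filter, Finset.mem_univ, true_and]
  constructor
  · rintro ⟨x, hx, ha⟩
    exact ha.mem_coordFlag_iff.1 hx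
  · exact fun h => ⟨v a, basis_mem_coordFlag_iff.2 h, lead_basis a⟩

/-- Translates rank conditions relative to the flag into counting functions of finite sets of
positions. -/
theorem finrank_inf_coordFlag (L : Submodule K V) (j : ℕ) :
    Module.finrank K (L ⊓ coordFlag v j : Submodule K V) =
      ((jumps v L).filter fun a : Fin n => (a : ℕ) < j).card := by
  rw [← jumps_inf_coordFlag, card_jumps]

theorem eq_of_le_of_jumps_subset {L L' : Submodule K V} (h : L ≤ L')
    (hj : jumps v L' ⊆ jumps v L) : L = L' := by
  have hfin : Module.Finite K V := Module.Finite.of_basis v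
  refine Submodule.eq_of_le_of_finrank_le h ?_
  rw [← card_jumps (v := v), ← card_jumps (v := v)]
  exact Finset.card_le_card hj

theorem coordFlag_le_of_forall_mem_jumps {L : Submodule K V} {j : ℕ}
    (h : ∀ a : Fin n, (a : ℕ) < j → a ∈ jumps v L) : coordFlag v j ≤ L := by
  have : L ⊓ coordFlag v j = coordFlag v j := by
    refine eq_of_le_of_jumps_subset (v := v) inf_le_right ?_
    rw [jumps_inf_coordFlag, jumps_coordFlag]
    intro a ha
    simp only [Finset.mem_filter, Finset.mem_univ, true_and] at ha ⊢
    exact ⟨h a ha, ha⟩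
  exact inf_eq_right.1 this

theorem le_coordFlag_of_forall_jumps_lt {L : Submodule K V} {j : ℕ}
    (h : ∀ a ∈ jumps v L, (a : ℕ) < j) : L ≤ coordFlag v j := by
  intro x hx
  by_cases h0 : x = 0
  · rw [h0]
    exact Submodule.zero_mem _
  · obtain ⟨a, ha⟩ := exists_lead (v := v) h0
    exact ha.mem_coordFlag_iff.2 (h a (mem_jumps.2 ⟨x, hx, ha⟩))

theorem jumps_map_borel {g : V ≃ₗ[K] V} (hg : g ∈ borelSubgroup v) (L : Submodule K V) :
    jumps v (L.map (g : V →ₗ[K] V)) = jumps v L := by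
  ext a
  simp only [mem_jumps]
  constructor
  · rintro ⟨_, ⟨x, hx, rfl⟩, ha⟩
    refine ⟨x, hx, ?_⟩
    have h2 := Lead.map_borel (inv_mem hg) ha
    have h3 : g⁻¹ ((g : V →ₗ[K] V) x) = x := g.symm_apply_apply x
    rwa [h3] at h2
  · rintro ⟨x, hx, ha⟩
    exact ⟨g x, ⟨x, hx, rfl⟩, ha.map_borel hg⟩

/-- The coordinate subspace spanned by the basis vectors with index in `A`. -/
def coordSpan (v : Module.Basis (Fin n) K V) (A : Finset (Fin n)) : Submodule K V :=
  Submodule.span K (v '' A)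

theorem finrank_coordSpan (A : Finset (Fin n)) : Module.finrank K (coordSpan v A) = A.card := by
  have h : LinearIndependent K (fun a : A => v a) :=
    v.linearIndependent.comp _ Subtype.val_injective
  have hr : v '' A = Set.range fun a : A => v a := by
    ext x
    simp
  rw [coordSpan, hr, finrank_span_eq_card h, Fintype.card_coe]

theorem jumps_coordSpan (A : Finset (Fin n)) : jumps v (coordSpan v A) = A := by
  refine (Finset.eq_of_subset_of_card_le ?_ ?_).symm
  · intro a ha
    exact mem_jumps.2 ⟨v a, Submodule.subset_span ⟨a, ha, rfl⟩, lead_basis a⟩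
  · rw [card_jumps, finrank_coordSpan]

/-- Two subspaces whose common jumps are exactly those of a member of the flag are simultaneously
conjugate under `B` to coordinate subspaces. -/
theorem exists_borel_map_coordSpan {U W : Submodule K V} {d : ℕ}
    (h : ∀ a, a ∈ jumps v U ∧ a ∈ jumps v W ↔ (a : ℕ) < d) :
    ∃ g ∈ borelSubgroup v, (coordSpan v (jumps v U)).map (g : V →ₗ[K] V) = U ∧
      (coordSpan v (jumps v W)).map (g : V →ₗ[K] V) = W := by
  have hfin : Module.Finite K V := Module.Finite.of_basis v
  have hU : coordFlag v d ≤ U := coordFlag_le_of_forall_mem_jumps fun a ha => ((h a).2 ha).1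
  have hW : coordFlag v d ≤ W := coordFlag_le_of_forall_mem_jumps fun a ha => ((h a).2 ha).2
  -- A common jump lies among the first d positions, where the basis vector itself is in both
  -- subspaces. Elsewhere at most one subspace constrains the choice.
  have hy : ∀ a, ∃ y, Lead v y a ∧ (a ∈ jumps v U → y ∈ U) ∧ (a ∈ jumps v W → y ∈ W) := by
    intro a
    by_cases hd : (a : ℕ) < d
    · have := basis_mem_coordFlag_iff (v := v).2 hd
      exact ⟨v a, lead_basis a, fun _ => hU this, fun _ => hW this⟩
    · by_cases haU : a ∈ jumps v U
      · obtain ⟨x, hx, hxa⟩ := mem_jumps.1 haU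
        exact ⟨x, hxa, fun _ => hx, fun haW => absurd ((h a).1 ⟨haU, haW⟩) hd⟩
      · by_cases haW : a ∈ jumps v W
        · obtain ⟨x, hx, hxa⟩ := mem_jumps.1 haW
          exact ⟨x, hxa, fun hh => absurd hh haU, fun _ => hx⟩
        · exact ⟨v a, lead_basis a, fun hh => absurd hh haU, fun hh => absurd hh haW⟩
  choose y hy hyU hyW using hy
  obtain ⟨g, hg, hgy⟩ := exists_borel_apply_eq hy
  refine ⟨g, hg, ?_, ?_⟩
  · refine eq_of_le_of_jumps_subset (v := v) ?_ ?_
    · rw [coordSpan, Submodule.map_span_le]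
      rintro _ ⟨a, ha, rfl⟩
      exact (hgy a).symm ▸ hyU a ha
    · rw [jumps_map_borel hg, jumps_coordSpan]
  · refine eq_of_le_of_jumps_subset (v := v) ?_ ?_
    · rw [coordSpan, Submodule.map_span_le]
      rintro _ ⟨a, ha, rfl⟩
      exact (hgy a).symm ▸ hyW a ha
    · rw [jumps_map_borel hg, jumps_coordSpan]

end Jumps

end DoubleGrassmannian

namespace DoubleGrassmannian

/-! ### Minimal parabolic subgroups and representatives of B \ P_i -/

section Parabolic

variable {K V : Type*} [Field K] [AddCommGroup V] [Module K V] {n : ℕ}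

/-- The position of the first of the two basis vectors exchanged by `s_i`. -/
def lo (i : Fin (n - 1)) : Fin n := ⟨i, by omega⟩

/-- The position of the second of the two basis vectors exchanged by `s_i`. -/
def hi (i : Fin (n - 1)) : Fin n := ⟨i + 1, by omega⟩

theorem lo_ne_hi (i : Fin (n - 1)) : lo i ≠ hi i := by simp [lo, hi]

variable (v : Module.Basis (Fin n) K V)

/-- The unipotent transformation `v_i ↦ v_i + t v_{i+1}`. -/
noncomputable def lowerUnipotent (i : Fin (n - 1)) (t : K) : V ≃ₗ[K] V :=
  LinearEquiv.transvection (f := v.coord (lo i)) (v := t • v (hi i))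
    (by simp [(lo_ne_hi i).symm])

/-- The unipotent transformation `v_{i+1} ↦ v_{i+1} + t v_i`. -/
noncomputable def upperUnipotent (i : Fin (n - 1)) (t : K) : V ≃ₗ[K] V :=
  LinearEquiv.transvection (f := v.coord (hi i)) (v := t • v (lo i))
    (by simp [lo_ne_hi i])

variable {v}

theorem lowerUnipotent_apply (i : Fin (n - 1)) (t : K) (x : V) :
    lowerUnipotent v i t x = x + t • v.repr x (lo i) • v (hi i) := by
  rw [lowerUnipotent, LinearEquiv.transvection.apply, smul_comm]
  rfl

theorem upperUnipotent_apply (i : Fin (n - 1)) (t : K) (x : V) :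
    upperUnipotent v i t x = x + t • v.repr x (hi i) • v (lo i) := by
  rw [upperUnipotent, LinearEquiv.transvection.apply, smul_comm]
  rfl

theorem lowerUnipotent_neg (i : Fin (n - 1)) (t : K) :
    lowerUnipotent v i (-t) = (lowerUnipotent v i t)⁻¹ := by
  rw [eq_inv_iff_mul_eq_one]
  ext x
  simp [LinearEquiv.mul_apply, lowerUnipotent_apply, (lo_ne_hi i).symm]

theorem lowerUnipotent_zero (i : Fin (n - 1)) : lowerUnipotent v i 0 = 1 := by
  ext x
  simp [lowerUnipotent_apply]

theorem repr_simpleReflection (i : Fin (n - 1)) (x : V) (a : Fin n) :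
    v.repr (simpleReflection v i x) a = v.repr x (Equiv.swap (lo i) (hi i) a) := by
  have h : (v.coord a).comp (simpleReflection v i : V →ₗ[K] V) =
      v.coord (Equiv.swap (lo i) (hi i) a) := by
    refine v.ext fun b => ?_
    have : simpleReflection v i (v b) = v (Equiv.swap (lo i) (hi i) b) :=
      Module.Basis.equiv_apply _ _ _ _
    simp only [LinearMap.comp_apply, LinearEquiv.coe_coe, this, Module.Basis.coord_apply,
      Module.Basis.repr_self, Finsupp.single_apply]
    congr 1
    rw [eq_iff_iff]
    constructor
    · rintro rfl
      simp
    · rintro rfl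
      simp
  exact LinearMap.congr_fun h x

theorem simpleReflection_mul_self (i : Fin (n - 1)) :
    simpleReflection v i * simpleReflection v i = 1 := by
  ext x
  refine v.repr.injective (Finsupp.ext fun a => ?_)
  rw [LinearEquiv.mul_apply, repr_simpleReflection, repr_simpleReflection, Equiv.swap_apply_self]
  rfl

variable (v) in
/-- The stabilizer of the partial flag without its `i`-th member. -/
def parabolicSubgroup (i : Fin (n - 1)) : Subgroup (V ≃ₗ[K] V) :=
  ⨅ j : {j : ℕ // j ≠ i + 1}, MulAction.stabilizer (V ≃ₗ[K] V) (coordFlag v j)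

theorem mem_parabolicSubgroup_iff {i : Fin (n - 1)} {g : V ≃ₗ[K] V} :
    g ∈ parabolicSubgroup v i ↔
      ∀ j : ℕ, j ≠ i + 1 → ∀ x ∈ coordFlag v j, g x ∈ coordFlag v j := by
  have : Module.Finite K V := Module.Finite.of_basis v
  simp only [parabolicSubgroup, Subgroup.mem_iInf, mem_stabilizer_iff_forall, Subtype.forall]

theorem borelSubgroup_le_parabolicSubgroup (i : Fin (n - 1)) :
    borelSubgroup v ≤ parabolicSubgroup v i := fun _ hg =>
  mem_parabolicSubgroup_iff.2 fun j _ => mem_borelSubgroup_iff.1 hg j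

theorem simpleReflection_mem (i : Fin (n - 1)) : simpleReflection v i ∈ parabolicSubgroup v i := by
  refine mem_parabolicSubgroup_iff.2 fun j hj x hx a ha => ?_
  rw [repr_simpleReflection]
  refine hx _ ?_
  by_cases h1 : a = lo i
  · rw [h1, Equiv.swap_apply_left]
    simp only [h1, lo, hi] at *
    omega
  · by_cases h2 : a = hi i
    · rw [h2, Equiv.swap_apply_right]
      simp only [h2, lo, hi] at *
      omega
    · rwa [Equiv.swap_apply_of_ne_of_ne h1 h2]

/-- Members of the flag up to F_i are fixed pointwise because φ vanishes there, and those from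
F_{i+2} on absorb w; only F_{i+1} can move. -/
theorem add_smul_mem_parabolicSubgroup {i : Fin (n - 1)} {g : V ≃ₗ[K] V} {w : V}
    {φ : Module.Dual K V} (hg : ∀ x, g x = x + φ x • w) (hw : w ∈ coordFlag v (i + 2))
    (hφ : ∀ x ∈ coordFlag v i, φ x = 0) : g ∈ parabolicSubgroup v i := by
  refine mem_parabolicSubgroup_iff.2 fun j hj x hx => ?_
  rw [hg]
  rcases Nat.lt_or_ge j (i + 2) with h | h
  · rw [hφ x (coordFlag_mono (by omega) hx), zero_smul, add_zero]
    exact hx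
  · exact Submodule.add_mem _ hx (Submodule.smul_mem _ _ (coordFlag_mono h hw))

theorem lowerUnipotent_mem (i : Fin (n - 1)) (t : K) :
    lowerUnipotent v i t ∈ parabolicSubgroup v i := by
  refine add_smul_mem_parabolicSubgroup (w := v (hi i)) (φ := t • v.coord (lo i)) (fun x => ?_)
    (basis_mem_coordFlag_iff.2 (by simp [hi])) fun x hx => ?_
  · rw [lowerUnipotent_apply, smul_smul]
    rfl
  · simp [hx (lo i) le_rfl]

theorem upperUnipotent_mem_borelSubgroup (i : Fin (n - 1)) (t : K) :
    upperUnipotent v i t ∈ borelSubgroup v := by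
  rw [mem_borelSubgroup_iff]
  intro j x hx
  rw [upperUnipotent_apply]
  by_cases hj : j ≤ i + 1
  · rw [hx (hi i) hj, zero_smul, smul_zero, add_zero]
    exact hx
  · refine Submodule.add_mem _ hx (Submodule.smul_mem _ _ (Submodule.smul_mem _ _ ?_))
    exact basis_mem_coordFlag_iff.2 (by simp only [lo]; omega)

theorem sub_smul_mem_coordFlag {j : ℕ} {a : Fin n} (ha : (a : ℕ) = j) {x : V}
    (hx : x ∈ coordFlag v (j + 1)) : x - v.repr x a • v a ∈ coordFlag v j := by
  intro b hb
  by_cases hab : b = a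
  · simp [hab]
  · have : (b : ℕ) ≠ a := fun h => hab (Fin.ext h)
    have h1 := hx b (by omega)
    simp [h1, Ne.symm hab]

theorem mem_coordFlag_of_repr_eq_zero {j : ℕ} {a : Fin n} (ha : (a : ℕ) = j) {x : V}
    (hx : x ∈ coordFlag v (j + 1)) (h : v.repr x a = 0) : x ∈ coordFlag v j := by
  have := sub_smul_mem_coordFlag ha hx
  rwa [h, zero_smul, sub_zero] at this

/-- F_{i+1} is spanned by F_i and one more basis vector, so that vector alone has to be tested. -/
theorem mem_borelSubgroup_of_mem_parabolicSubgroup {i : Fin (n - 1)} {g : V ≃ₗ[K] V}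
    (hg : g ∈ parabolicSubgroup v i) (hgi : g (v (lo i)) ∈ coordFlag v (i + 1)) :
    g ∈ borelSubgroup v := by
  rw [mem_parabolicSubgroup_iff] at hg
  rw [mem_borelSubgroup_iff]
  intro j x hx
  by_cases hj : j = i + 1
  · subst hj
    have h1 := hg i (by omega) _ (sub_smul_mem_coordFlag (a := lo i) rfl hx)
    rw [map_sub, map_smul] at h1
    rw [← sub_add_cancel (g x) (v.repr x (lo i) • g (v (lo i)))]
    exact Submodule.add_mem _ (coordFlag_mono (Nat.le_succ _) h1) (Submodule.smul_mem _ _ hgi)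
  · exact hg j hj x hx

/-- For `w` in the `(i+1)`-st, but not in the `i`-th member of the flag, one of the standard
representatives of `B \ P_i` moves `w` into the `i`-th member. -/
theorem exists_representative {i : Fin (n - 1)} {w : V} (hw : w ∈ coordFlag v (i + 2)) :
    ∃ h : V ≃ₗ[K] V, (h = simpleReflection v i ∨ ∃ t, h = lowerUnipotent v i t) ∧
      h w ∈ coordFlag v (i + 1) := by
  by_cases h0 : v.repr w (lo i) = 0
  · refine ⟨simpleReflection v i, Or.inl rfl, ?_⟩
    refine mem_coordFlag_of_repr_eq_zero (a := hi i) rfl ?_ ?_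
    · exact mem_parabolicSubgroup_iff.1 (simpleReflection_mem i) (i + 2) (by omega) _ hw
    · rw [repr_simpleReflection, Equiv.swap_apply_right, h0]
  -- The parameter is the one that cancels the coordinate at `hi i`.
  · refine ⟨lowerUnipotent v i (-(v.repr w (hi i) / v.repr w (lo i))), Or.inr ⟨_, rfl⟩, ?_⟩
    refine mem_coordFlag_of_repr_eq_zero (a := hi i) rfl ?_ ?_
    · exact mem_parabolicSubgroup_iff.1 (lowerUnipotent_mem i _) (i + 2) (by omega) _ hw
    · rw [lowerUnipotent_apply]
      simp [h0]

theorem representative_mem {i : Fin (n - 1)} {h : V ≃ₗ[K] V}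
    (hh : h = simpleReflection v i ∨ ∃ t, h = lowerUnipotent v i t) :
    h ∈ parabolicSubgroup v i := by
  rcases hh with rfl | ⟨t, rfl⟩
  · exact simpleReflection_mem i
  · exact lowerUnipotent_mem i t

theorem exists_representative_mul_mem {i : Fin (n - 1)} {g : V ≃ₗ[K] V}
    (hg : g ∈ parabolicSubgroup v i) :
    ∃ h : V ≃ₗ[K] V, (h = simpleReflection v i ∨ ∃ t, h = lowerUnipotent v i t) ∧
      h * g ∈ borelSubgroup v := by
  obtain ⟨h, hh, hw⟩ := exists_representative (v := v) (i := i) (w := g (v (lo i)))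
    (mem_parabolicSubgroup_iff.1 hg _ (by omega) _
      (basis_mem_coordFlag_iff.2 (by simp [lo])))
  exact ⟨h, hh, mem_borelSubgroup_of_mem_parabolicSubgroup
    (mul_mem (representative_mem hh) hg) hw⟩

/-- The change of charts t ↦ 1/t on the projective line B \ P_i. -/
theorem reflected_mul_lowerUnipotent_inv_mem (i : Fin (n - 1)) {t : K} (ht : t ≠ 0) :
    simpleReflection v i * upperUnipotent v i t⁻¹ * (lowerUnipotent v i t)⁻¹ ∈
      borelSubgroup v := by
  have hmem : simpleReflection v i * upperUnipotent v i t⁻¹ * (lowerUnipotent v i t)⁻¹ ∈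
      parabolicSubgroup v i :=
    mul_mem (mul_mem (simpleReflection_mem i)
      (borelSubgroup_le_parabolicSubgroup i (upperUnipotent_mem_borelSubgroup i _)))
      (inv_mem (lowerUnipotent_mem i t))
  refine mem_borelSubgroup_of_mem_parabolicSubgroup hmem ?_
  refine mem_coordFlag_of_repr_eq_zero (a := hi i) rfl ?_ ?_
  · exact mem_parabolicSubgroup_iff.1 hmem (i + 2) (by omega) _
      (basis_mem_coordFlag_iff.2 (by simp [lo]))
  · rw [← lowerUnipotent_neg, LinearEquiv.mul_apply, LinearEquiv.mul_apply,
      repr_simpleReflection, Equiv.swap_apply_right, upperUnipotent_apply, lowerUnipotent_apply]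
    simp [lo_ne_hi i, (lo_ne_hi i).symm, ht]

/-- Every coset of B in the stabilizer of the partial flag has a standard representative. The
unipotent ones with t ≠ 0 fall into B s_i B by the change of charts, and t = 0 gives B. -/
theorem minimalParabolic_eq (i : Fin (n - 1)) :
    minimalParabolic v i = parabolicSubgroup v i := by
  ext g
  rw [minimalParabolic, Set.mem_union, DoubleCoset.mem_doubleCoset]
  constructor
  · rintro (hg | ⟨b, hb, b', hb', rfl⟩)
    · exact borelSubgroup_le_parabolicSubgroup i hg
    · exact mul_mem (mul_mem (borelSubgroup_le_parabolicSubgroup i hb) (simpleReflection_mem i))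
        (borelSubgroup_le_parabolicSubgroup i hb')
  · intro hg
    obtain ⟨h, rfl | ⟨t, rfl⟩, hb⟩ := exists_representative_mul_mem hg
    · refine Or.inr ⟨1, one_mem _, _, hb, ?_⟩
      rw [one_mul, ← mul_assoc, simpleReflection_mul_self, one_mul]
    · by_cases ht : t = 0
      · rw [ht, lowerUnipotent_zero, one_mul] at hb
        exact Or.inl hb
      · have h1 := reflected_mul_lowerUnipotent_inv_mem (v := v) i (neg_ne_zero.2 ht)
        refine Or.inr ⟨_, inv_mem h1, _,
          mul_mem (upperUnipotent_mem_borelSubgroup i (-t)⁻¹) hb, ?_⟩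
        rw [lowerUnipotent_neg]
        group

end Parabolic

end DoubleGrassmannian

namespace DoubleGrassmannian

/-! ### Closedness of P_i Z, density in P_i x, and the criterion for non-minimality -/

section ParabolicClosure

variable {K V : Type*} [Field K] [AddCommGroup V] [Module K V] {n k l : ℕ}

/-- Membership of the points of a curve in a closed set is a polynomial condition. -/
theorem exists_polynomials_mem_iff {Z : Set (X K V k l)} (hZ : IsClosed Z) (c : K → V ≃ₗ[K] V)
    (L₀ L₁ : V →ₗ[K] V) (hc : ∀ t y, c t y = L₀ y + t • L₁ y) :
    ∃ S : Set (Polynomial (polyFun K ((Fin k → V) × (Fin l → V)))),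
      ∀ (q : Frames K V k l) (t : K),
        c t • q.span ∈ Z ↔ ∀ P ∈ S, (P.map (evalAt (q.u, q.w))).eval t = 0 := by
  have hmap : ∀ (q : Frames K V k l) (t : K), ((q.map (c t)).u, (q.map (c t)).w) =
      prodMap k l L₀ (q.u, q.w) + t • prodMap k l L₁ (q.u, q.w) := fun q t => by
    refine Prod.ext (funext fun a => ?_) (funext fun a => ?_)
    · exact hc t (q.u a)
    · exact hc t (q.w a)
  refine ⟨{P | ∃ f ∈ polyFun K ((Fin k → V) × (Fin l → V)),
    (∀ q : Frames K V k l, q.span ∈ Z → f (q.u, q.w) = 0) ∧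
    ∀ t y, f (prodMap k l L₀ y + t • prodMap k l L₁ y) = (P.map (evalAt y)).eval t},
    fun q t => ⟨?_, ?_⟩⟩
  · rintro hq P ⟨f, _, hfZ, hP⟩
    rw [← hP, ← hmap]
    refine hfZ _ ?_
    rwa [Frames.span_map]
  · intro h
    by_contra hq
    rw [← Frames.span_map] at hq
    obtain ⟨f, hf, hfq, hfZ⟩ := isClosed_X_iff.1 hZ _ hq
    obtain ⟨P, hP⟩ := exists_polynomial_eval_line hf (prodMap k l L₀) (prodMap k l L₁)
    refine hfq ?_
    rw [hmap, hP]
    exact h P ⟨f, hf, hfZ, hP⟩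

/-- A closed set that contains almost all points of a curve contains all of them. -/
theorem smul_mem_of_forall_eval_ne_zero [Infinite K] [Module.Finite K V] {Z : Set (X K V k l)}
    (hZ : IsClosed Z) (c : K → V ≃ₗ[K] V) (L₀ L₁ : V →ₗ[K] V)
    (hc : ∀ t y, c t y = L₀ y + t • L₁ y) {x : X K V k l} {F : Polynomial K} (hF : F ≠ 0)
    (h : ∀ t, F.eval t ≠ 0 → c t • x ∈ Z) (t : K) : c t • x ∈ Z := by
  obtain ⟨S, hS⟩ := exists_polynomials_mem_iff hZ c L₀ L₁ hc
  obtain ⟨p, rfl⟩ := Frames.exists_span_eq x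
  rw [hS]
  intro P hP
  -- Multiplying by F removes the exceptional parameters; a polynomial vanishing on the infinite
  -- field K is zero, and F cancels.
  have hmul : P.map (evalAt (p.u, p.w)) * F = 0 := by
    refine Polynomial.funext fun r => ?_
    rw [Polynomial.eval_mul, Polynomial.eval_zero]
    by_cases hr : F.eval r = 0
    · rw [hr, mul_zero]
    · rw [(hS p r).1 (h r hr) P hP, zero_mul]
  rw [(mul_eq_zero.1 hmul).resolve_right hF, Polynomial.eval_zero]

variable {v : Module.Basis (Fin n) K V}

/-- The linear dependence of `lowerUnipotent` on its parameter. -/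
theorem lowerUnipotent_eq (i : Fin (n - 1)) (t : K) (x : V) : lowerUnipotent v i t x =
    LinearMap.id (R := K) x + t • (v.coord (lo i)).smulRight (v (hi i)) x :=
  lowerUnipotent_apply i t x

theorem reflected_upperUnipotent_eq (i : Fin (n - 1)) (t : K) (x : V) :
    (simpleReflection v i * upperUnipotent v i t) x = (simpleReflection v i : V →ₗ[K] V) x +
      t • ((simpleReflection v i : V →ₗ[K] V).comp
        ((v.coord (hi i)).smulRight (v (lo i)))) x := by
  rw [LinearEquiv.mul_apply, upperUnipotent_apply, map_add, map_smul]
  rfl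

theorem upperUnipotent_zero (i : Fin (n - 1)) : upperUnipotent v i 0 = 1 := by
  ext x
  simp [upperUnipotent_apply]

/-- The two charts of `B \ P_i` agree on their overlap. -/
theorem lowerUnipotent_smul_mem_iff {Z : Set (X K V k l)}
    (hB : ∀ b ∈ borelSubgroup v, ∀ z ∈ Z, b • z ∈ Z) (i : Fin (n - 1)) {t : K} (ht : t ≠ 0)
    (x : X K V k l) : lowerUnipotent v i t • x ∈ Z ↔
      (simpleReflection v i * upperUnipotent v i t⁻¹) • x ∈ Z := by
  have hb := reflected_mul_lowerUnipotent_inv_mem (v := v) i ht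
  constructor
  · intro h
    have := hB _ hb _ h
    rwa [smul_smul, inv_mul_cancel_right] at this
  · intro h
    have := hB _ (inv_mem hb) _ h
    rwa [smul_smul, mul_inv_rev, inv_inv, inv_mul_cancel_right] at this

/-- Since Z is B-stable, only the coset in B \ P_i of the element carrying x into Z matters, so
membership is a question about the points of a projective line. -/
theorem mem_parabolicSubgroup_smul_iff {Z : Set (X K V k l)}
    (hB : ∀ b ∈ borelSubgroup v, ∀ z ∈ Z, b • z ∈ Z) (i : Fin (n - 1)) (x : X K V k l) :
    x ∈ (parabolicSubgroup v i : Set (V ≃ₗ[K] V)) • Z ↔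
      simpleReflection v i • x ∈ Z ∨ ∃ t, lowerUnipotent v i t • x ∈ Z := by
  constructor
  · rintro ⟨g, hg, z, hz, rfl⟩
    obtain ⟨h, hh, hb⟩ := exists_representative_mul_mem hg
    have hz' := hB _ hb _ hz
    rw [mul_smul] at hz'
    rcases hh with rfl | ⟨t, rfl⟩
    · exact Or.inl hz'
    · exact Or.inr ⟨t, hz'⟩
  · rintro (h | ⟨t, h⟩)
    · exact ⟨_, inv_mem (simpleReflection_mem i), _, h, inv_smul_smul _ _⟩
    · exact ⟨_, inv_mem (lowerUnipotent_mem i t), _, h, inv_smul_smul _ _⟩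

/-- Since `P_i / B` is a projective line, `P_i Z` is closed for every `B`-stable closed set. -/
theorem isClosed_parabolicSubgroup_smul [IsAlgClosed K] {Z : Set (X K V k l)} (hZ : IsClosed Z)
    (hB : ∀ b ∈ borelSubgroup v, ∀ z ∈ Z, b • z ∈ Z) (i : Fin (n - 1)) :
    IsClosed ((parabolicSubgroup v i : Set (V ≃ₗ[K] V)) • Z) := by
  obtain ⟨S, hS⟩ := exists_polynomials_mem_iff hZ _ _ _ (lowerUnipotent_eq (v := v) i)
  obtain ⟨S', hS'⟩ := exists_polynomials_mem_iff hZ _ _ _ (reflected_upperUnipotent_eq (v := v) i)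
  refine isClosed_X_iff.2 fun p hp => ?_
  rw [mem_parabolicSubgroup_smul_iff hB, not_or, not_exists] at hp
  -- The two families describe the condition in the two charts of the line; the reflection is the
  -- point 0 of the second chart.
  obtain ⟨r, hr, hrZ⟩ := exists_eliminant
    (fun q : Frames K V k l => evalAt (K := K) (q.u, q.w)) (fun q => evalAt_surjective _) S S' p
    (fun t => by
      have := mt (hS p t).2 (hp.2 t)
      push Not at this
      exact this)
    (fun t => by
      have hnot : (simpleReflection v i * upperUnipotent v i t) • p.span ∉ Z := by
        by_cases ht : t = 0
        · rw [ht, upperUnipotent_zero, mul_one]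
          exact hp.1
        · have := hp.2 t⁻¹
          rwa [lowerUnipotent_smul_mem_iff hB i (inv_ne_zero ht), inv_inv] at this
      have := mt (hS' p t).2 hnot
      push Not at this
      exact this)
  refine ⟨r, r.2, hr, fun q hq => hrZ q ?_⟩
  rw [mem_parabolicSubgroup_smul_iff hB] at hq
  rcases hq with hq | ⟨t, hq⟩
  · refine Or.inr (Or.inl ((hS' q 0).1 ?_))
    rwa [upperUnipotent_zero, mul_one]
  · by_cases ht : t = 0
    · subst ht
      exact Or.inl ((hS q 0).1 hq)
    · refine Or.inr (Or.inr ⟨t, ht, (hS q t).1 hq, (hS' q t⁻¹).1 ?_⟩)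
      rwa [← lowerUnipotent_smul_mem_iff hB i ht]

theorem mem_borel_orbit_iff {x y : X K V k l} :
    y ∈ MulAction.orbit (borelSubgroup v) x ↔ ∃ b ∈ borelSubgroup v, b • x = y :=
  ⟨fun ⟨b, hb⟩ => ⟨b, b.2, hb⟩, fun ⟨b, hb, h⟩ => ⟨⟨b, hb⟩, h⟩⟩

theorem borel_smul_mem_closure_orbit (x : X K V k l) :
    ∀ b ∈ borelSubgroup v, ∀ z ∈ closure (MulAction.orbit (borelSubgroup v) x),
      b • z ∈ closure (MulAction.orbit (borelSubgroup v) x) := by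
  intro b hb
  have hcl : IsClosed ((b • ·) ⁻¹' closure (MulAction.orbit (borelSubgroup v) x)) :=
    isClosed_closure.preimage (continuous_const_smul b)
  refine fun z hz => closure_minimal ?_ hcl hz
  intro y hy
  obtain ⟨b', hb', rfl⟩ := mem_borel_orbit_iff.1 hy
  exact subset_closure (mem_borel_orbit_iff.2 ⟨b * b', mul_mem hb hb', mul_smul _ _ _⟩)

/-- A transvection-like family in the stabilizer of `x` that moves the `i`-th member of the flag
makes the orbit of `x` dense in `P_i x`. -/
theorem parabolic_smul_mem_closure_orbit [IsAlgClosed K] {x : X K V k l} {i : Fin (n - 1)} {w : V}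
    {φ : Module.Dual K V} (hw : w ∈ coordFlag v (i + 2)) (hw' : w ∉ coordFlag v (i + 1))
    (hφ : ∀ y ∈ coordFlag v i, φ y = 0) (hφi : φ (v (lo i)) ≠ 0)
    (hU : w ∈ x.U.space ∨ ∀ y ∈ x.U.space, φ y = 0)
    (hW : w ∈ x.W.space ∨ ∀ y ∈ x.W.space, φ y = 0) :
    ∀ g ∈ parabolicSubgroup v i, g • x ∈ closure (MulAction.orbit (borelSubgroup v) x) := by
  have hfin : Module.Finite K V := Module.Finite.of_basis v
  have hinf : Infinite K := IsAlgClosed.instInfinite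
  set Z := closure (MulAction.orbit (borelSubgroup v) x) with hZdef
  have hZ : IsClosed Z := isClosed_closure
  have hB := borel_smul_mem_closure_orbit (v := v) x
  rw [← hZdef] at hB
  set α := v.repr w (lo i) with hα
  set β := v.repr w (hi i) with hβ
  have hβ0 : β ≠ 0 := fun h => hw' (mem_coordFlag_of_repr_eq_zero (a := hi i) rfl hw h)
  set c := φ (v (lo i)) with hc
  have hlow : ∀ t, lowerUnipotent v i t • x ∈ Z := by
    -- The first factor of F is the denominator of the scalar r below; the second makes y ↦ y +
    -- rφ(y)w invertible. Both are nonzero at t = 0.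
    refine smul_mem_of_forall_eval_ne_zero hZ _ _ _ (lowerUnipotent_eq (v := v) i)
      (F := (Polynomial.C β + Polynomial.C α * Polynomial.X) *
        (Polynomial.C c * (Polynomial.C β + Polynomial.C α * Polynomial.X) -
          Polynomial.C (φ w) * Polynomial.X)) ?_ ?_
    · intro h0
      have := congrArg (Polynomial.eval 0) h0
      simp [hβ0, hφi] at this
    · intro t ht
      simp only [Polynomial.eval_mul, Polynomial.eval_add, Polynomial.eval_sub,
        Polynomial.eval_C, Polynomial.eval_X] at ht
      have hD : β + α * t ≠ 0 := left_ne_zero_of_mul ht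
      have hD' : β + t * α ≠ 0 := by rwa [mul_comm t]
      have hI : c * (β + α * t) - φ w * t ≠ 0 := right_ne_zero_of_mul ht
      -- This solves rc(β + αt) + t = 0, the vanishing of the `hi i` coordinate after g and the
      -- lower unipotent are applied to the basis vector at `lo i`; their product then lies in B.
      set r := -t / (c * (β + α * t)) with hr
      have hunit : IsUnit (1 + (r • φ) w) := by
        rw [isUnit_iff_ne_zero, LinearMap.smul_apply, smul_eq_mul, hr]
        intro h0
        refine hI ?_
        field_simp at h0
        linear_combination h0
      let g := LinearEquiv.dilatransvection (f := r • φ) (v := w) hunit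
      have hg : ∀ y, g y = y + (r • φ) y • w := fun y => by
        exact LinearEquiv.dilatransvection.apply
      have hgP : g ∈ parabolicSubgroup v i :=
        add_smul_mem_parabolicSubgroup hg hw fun y hy => by simp [hφ y hy]
      have hstab : ∀ L : Submodule K V, (w ∈ L ∨ ∀ y ∈ L, φ y = 0) →
          L.map (g : V →ₗ[K] V) = L := by
        intro L hL
        refine Submodule.eq_of_le_of_finrank_eq ?_ (LinearEquiv.finrank_map_eq g L)
        rintro _ ⟨y, hy, rfl⟩
        rw [LinearEquiv.coe_coe, hg]
        rcases hL with h | h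
        · exact Submodule.add_mem _ hy (Submodule.smul_mem _ _ h)
        · simpa [h y hy] using hy
      have hgx : g • x = x := X.ext (Gr.ext (hstab _ hU)) (Gr.ext (hstab _ hW))
      have hmem : lowerUnipotent v i t * g ∈ borelSubgroup v := by
        have hP := mul_mem (lowerUnipotent_mem (v := v) i t) hgP
        refine mem_borelSubgroup_of_mem_parabolicSubgroup hP ?_
        refine mem_coordFlag_of_repr_eq_zero (a := hi i) rfl ?_ ?_
        · exact mem_parabolicSubgroup_iff.1 hP (i + 2) (by omega) _
            (basis_mem_coordFlag_iff.2 (by simp [lo]))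
        · rw [LinearEquiv.mul_apply, lowerUnipotent_apply, hg]
          simp only [map_add, map_smul, Finsupp.add_apply, Finsupp.smul_apply,
            Module.Basis.repr_self, smul_eq_mul, Finsupp.single_eq_same, LinearMap.smul_apply,
            Finsupp.single_eq_of_ne (lo_ne_hi i).symm, ← hα, ← hβ, ← hc, hr]
          field_simp
          ring
      refine subset_closure (mem_borel_orbit_iff.2 ⟨_, hmem, ?_⟩)
      rw [mul_smul, hgx]
  -- The remaining point of the projective line is a limit in the other chart, where all parameters
  -- t ≠ 0 are already covered.
  have hrefl : simpleReflection v i • x ∈ Z := by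
    have := smul_mem_of_forall_eval_ne_zero hZ _ _ _ (reflected_upperUnipotent_eq (v := v) i)
      (x := x) (F := Polynomial.X) Polynomial.X_ne_zero ?_ 0
    · rwa [upperUnipotent_zero, mul_one] at this
    · intro t ht
      rw [Polynomial.eval_X] at ht
      have := (lowerUnipotent_smul_mem_iff hB i (inv_ne_zero ht) x).1 (hlow _)
      rwa [inv_inv] at this
  intro g hg
  obtain ⟨h, hh, hb⟩ := exists_representative_mul_mem (inv_mem hg)
  have hhx : h • x ∈ Z := by
    rcases hh with rfl | ⟨t, rfl⟩
    · exact hrefl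
    · exact hlow t
  have := hB _ (inv_mem hb) _ hhx
  rwa [smul_smul, mul_inv_rev, inv_inv, inv_mul_cancel_right] at this

/-- The basic criterion for an orbit not to be minimal. -/
theorem not_isMinimalOrbit [IsAlgClosed K] {x : X K V k l} {i : Fin (n - 1)} {w : V}
    {φ : Module.Dual K V} (hw : w ∈ coordFlag v (i + 2)) (hw' : w ∉ coordFlag v (i + 1))
    (hφ : ∀ y ∈ coordFlag v i, φ y = 0) (hφi : φ (v (lo i)) ≠ 0)
    (hU : w ∈ x.U.space ∨ ∀ y ∈ x.U.space, φ y = 0)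
    (hW : w ∈ x.W.space ∨ ∀ y ∈ x.W.space, φ y = 0)
    (L : X K V k l → Submodule K V)
    (hL : ∀ (g : V ≃ₗ[K] V) y, L (g • y) = (L y).map (g : V →ₗ[K] V))
    (hwL : w ∈ L x) (hjump : lo i ∉ jumps v (L x)) :
    ¬ IsMinimalOrbit v (MulAction.orbit (borelSubgroup v) x) := by
  rintro ⟨-, hmin⟩
  have hdense := parabolic_smul_mem_closure_orbit hw hw' hφ hφi hU hW
  -- Since h moves w into F_{i+1}, the position `lo i` becomes a jump of L at h • x. It is not one
  -- at x, so the two B-orbits differ.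
  obtain ⟨h, hh, hhw⟩ := exists_representative hw
  have hhP := representative_mem hh
  have hlead : Lead v (h w) (lo i) := by
    refine ⟨fun h0 => hw' ?_, fun b hb => hhw b hb⟩
    have h1 : h w ∈ coordFlag v i := mem_coordFlag_of_repr_eq_zero (a := lo i) rfl hhw h0
    have h2 := mem_parabolicSubgroup_iff.1 (inv_mem hhP) i (by omega) _ h1
    have h3 : h⁻¹ (h w) = w := h.symm_apply_apply w
    rw [h3] at h2
    exact coordFlag_mono (Nat.le_succ _) h2
  have hne : h • x ∉ MulAction.orbit (borelSubgroup v) x := by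
    intro hmem
    obtain ⟨b, hb, hbx⟩ := mem_borel_orbit_iff.1 hmem
    refine hjump ?_
    rw [← jumps_map_borel hb, ← hL, hbx, hL]
    exact mem_jumps.2 ⟨h w, ⟨w, hwL, rfl⟩, hlead⟩
  refine hne ?_
  -- One step in the weak order suffices: P_i applied to the closure of the orbit of h • x is closed
  -- and contains the orbit of x, and density gives the other inclusion.
  rw [← hmin (MulAction.orbit (borelSubgroup v) (h • x)) ⟨_, rfl⟩ ⟨[i], ?_⟩]
  · exact MulAction.mem_orbit_self _
  rw [List.foldl_cons, List.foldl_nil, minimalParabolic_eq]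
  apply Set.Subset.antisymm
  · refine closure_minimal ?_
      (isClosed_parabolicSubgroup_smul isClosed_closure (borel_smul_mem_closure_orbit _) i)
    intro y hy
    obtain ⟨b, hb, rfl⟩ := mem_borel_orbit_iff.1 hy
    refine ⟨b * h⁻¹, mul_mem (borelSubgroup_le_parabolicSubgroup i hb) (inv_mem hhP), h • x,
      subset_closure (MulAction.mem_orbit_self _), ?_⟩
    change (b * h⁻¹) • h • x = b • x
    rw [smul_smul, inv_mul_cancel_right]
  · rintro _ ⟨g, hg, z, hz, rfl⟩
    have hcl : IsClosed ((g • ·) ⁻¹' closure (MulAction.orbit (borelSubgroup v) x)) :=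
      isClosed_closure.preimage (continuous_const_smul g)
    refine closure_minimal ?_ hcl hz
    intro y hy
    obtain ⟨b, hb, rfl⟩ := mem_borel_orbit_iff.1 hy
    have := hdense _ (mul_mem (mul_mem hg (borelSubgroup_le_parabolicSubgroup i hb)) hhP)
    rwa [mul_smul, mul_smul] at this

end ParabolicClosure

end DoubleGrassmannian

namespace DoubleGrassmannian

/-! ### Jump sets of minimal orbits -/

section Cells

variable {K V : Type*} [Field K] [AddCommGroup V] [Module K V] {n k l : ℕ}
  {v : Module.Basis (Fin n) K V}

/-- If `lo i` is not a jump, its basis vector is outside L + F_i and can be separated from that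
subspace by a functional. -/
theorem exists_dual_of_notMem_jumps {i : Fin (n - 1)} {L : Submodule K V}
    (h : lo i ∉ jumps v L) : ∃ φ : Module.Dual K V,
      (∀ y ∈ coordFlag v i, φ y = 0) ∧ φ (v (lo i)) ≠ 0 ∧ ∀ y ∈ L, φ y = 0 := by
  have hnot : v (lo i) ∉ L ⊔ coordFlag v i := by
    intro hmem
    obtain ⟨s, hs, f, hf, hsf⟩ := Submodule.mem_sup.1 hmem
    refine h (mem_jumps.2 ⟨s, hs, ?_⟩)
    rw [← eq_sub_iff_add_eq] at hsf
    rw [hsf]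
    constructor
    · simp [hf (lo i) le_rfl]
    · intro b hb
      simp [hf b hb.le, hb.ne]
  obtain ⟨φ, hφ, hker⟩ := Submodule.exists_le_ker_of_notMem hnot
  exact ⟨φ, fun y hy => hker (Submodule.mem_sup_right hy), hφ,
    fun y hy => hker (Submodule.mem_sup_left hy)⟩

theorem notMem_of_le_of_forall_succ {J : Finset (Fin n)}
    (h : ∀ i : Fin (n - 1), lo i ∉ J → hi i ∉ J) {a : Fin n} (ha : a ∉ J) :
    ∀ b, a ≤ b → b ∉ J := by
  suffices H : ∀ c : ℕ, ∀ hc : a + c < n, (⟨a + c, hc⟩ : Fin n) ∉ J by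
    intro b hab
    have hb : (a : ℕ) + (b - a) = b := by
      have := Fin.le_def.1 hab
      omega
    have := H (b - a) (by omega)
    convert! this
    exact hb.symm
  intro c
  induction c with
  | zero => exact fun _ => ha
  | succ c ih =>
    intro hc
    exact h ⟨a + c, by omega⟩ (ih (by omega))

/-- Once a position is missing all later ones are missing, so J is an initial segment and is
determined by its size. -/
theorem mem_iff_lt_card {J : Finset (Fin n)} (h : ∀ i : Fin (n - 1), lo i ∉ J → hi i ∉ J)
    (a : Fin n) : a ∈ J ↔ (a : ℕ) < J.card := by
  constructor
  · intro ha
    have hsub : Finset.Iic a ⊆ J := fun b hb => by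
      by_contra hbJ
      exact notMem_of_le_of_forall_succ h hbJ a (Finset.mem_Iic.1 hb) ha
    have := Finset.card_le_card hsub
    rw [Fin.card_Iic] at this
    omega
  · intro hlt
    by_contra ha
    have hsub : J ⊆ Finset.Iio a := fun b hb => by
      rw [Finset.mem_Iio]
      by_contra hab
      exact notMem_of_le_of_forall_succ h ha b (not_lt.1 hab) hb
    have := Finset.card_le_card hsub
    rw [Fin.card_Iio] at this
    omega

/-- The pairs of sets of jumps that belong to the minimal orbits: the common elements are the
first `d` indices, and all elements together are the first `m` indices. -/
structure IsAdapted (A A' : Finset (Fin n)) (d m : ℕ) : Prop where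
  inter : ∀ a, a ∈ A ∧ a ∈ A' ↔ (a : ℕ) < d
  union : ∀ a, a ∈ A ∨ a ∈ A' ↔ (a : ℕ) < m

theorem finrank_sup_of_mem_stratum [Module.Finite K V] {d : ℕ} {x : X K V k l}
    (hx : x ∈ stratum K V k l d) :
    Module.finrank K (x.U.space ⊔ x.W.space : Submodule K V) + d = k + l := by
  have h := Submodule.finrank_sup_add_finrank_inf_eq x.U.space x.W.space
  rw [Gr.finrank_space, Gr.finrank_space] at h
  rw [← h, ← hx]

theorem card_filter_lt {j : ℕ} (hj : j ≤ n) :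
    (Finset.univ.filter fun a : Fin n => (a : ℕ) < j).card = j := by
  rw [Fin.card_filter_val_lt, min_eq_right hj]

/-- An ascent (a jump at `hi i` but not at `lo i`) in the jump set of U ∩ W, in that of U + W, or in
the union of those of U and W would yield w and φ as in `not_isMinimalOrbit`. So all three are
initial segments, and comparing sizes identifies the intersection and the union of the jump sets. -/
theorem isAdapted_of_isMinimalOrbit [IsAlgClosed K] {d : ℕ} {x : X K V k l}
    (hx : x ∈ stratum K V k l d)
    (hmin : IsMinimalOrbit v (MulAction.orbit (borelSubgroup v) x)) :
    IsAdapted (jumps v x.U.space) (jumps v x.W.space) d (k + l - d) := by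
  have hfin : Module.Finite K V := Module.Finite.of_basis v
  set JU := jumps v x.U.space with hJU
  set JW := jumps v x.W.space with hJW
  have hlead : ∀ {i : Fin (n - 1)} {w : V}, Lead v w (hi i) →
      w ∈ coordFlag v (i + 2) ∧ w ∉ coordFlag v (i + 1) := fun h =>
    ⟨h.mem_coordFlag_iff.2 (by simp [hi]), fun h' => by
      have := h.mem_coordFlag_iff.1 h'
      simp [hi] at this⟩
  -- Here w lies in both subspaces, so the coordinate functional will do for φ.
  have hD : ∀ i : Fin (n - 1), lo i ∉ jumps v (x.U.space ⊓ x.W.space) →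
      hi i ∉ jumps v (x.U.space ⊓ x.W.space) := by
    intro i hlo hhi
    obtain ⟨w, hw, hwl⟩ := mem_jumps.1 hhi
    refine not_isMinimalOrbit (hlead hwl).1 (hlead hwl).2 (φ := v.coord (lo i)) ?_ (by simp)
      (Or.inl hw.1) (Or.inl hw.2) (fun x => x.U.space ⊓ x.W.space) ?_ hw hlo hmin
    · exact fun y hy => hy (lo i) le_rfl
    · exact fun g y => (Submodule.map_inf _ g.injective).symm
  -- Dually, φ kills both subspaces, so w need not lie in either.
  have hS : ∀ i : Fin (n - 1), lo i ∉ jumps v (x.U.space ⊔ x.W.space) →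
      hi i ∉ jumps v (x.U.space ⊔ x.W.space) := by
    intro i hlo hhi
    obtain ⟨w, hw, hwl⟩ := mem_jumps.1 hhi
    obtain ⟨φ, hφ, hφi, hφL⟩ := exists_dual_of_notMem_jumps hlo
    refine not_isMinimalOrbit (hlead hwl).1 (hlead hwl).2 hφ hφi
      (Or.inr fun y hy => hφL y (Submodule.mem_sup_left hy))
      (Or.inr fun y hy => hφL y (Submodule.mem_sup_right hy))
      (fun x => x.U.space ⊔ x.W.space) ?_ hw hlo hmin
    exact fun g y => (Submodule.map_sup _ _ _).symm
  -- The mixed case: w lies in one subspace and φ kills the other.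
  have hUW : ∀ i : Fin (n - 1), lo i ∉ JU ∪ JW → hi i ∉ JU ∪ JW := by
    intro i hlo hhi
    rw [Finset.mem_union, not_or] at hlo
    rcases Finset.mem_union.1 hhi with hhi | hhi
    · obtain ⟨w, hw, hwl⟩ := mem_jumps.1 hhi
      obtain ⟨φ, hφ, hφi, hφL⟩ := exists_dual_of_notMem_jumps hlo.2
      exact not_isMinimalOrbit (hlead hwl).1 (hlead hwl).2 hφ hφi (Or.inl hw) (Or.inr hφL)
        (fun x => x.U.space) (fun _ _ => rfl) hw hlo.1 hmin
    · obtain ⟨w, hw, hwl⟩ := mem_jumps.1 hhi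
      obtain ⟨φ, hφ, hφi, hφL⟩ := exists_dual_of_notMem_jumps hlo.1
      exact not_isMinimalOrbit (hlead hwl).1 (hlead hwl).2 hφ hφi (Or.inr hφL) (Or.inl hw)
        (fun x => x.W.space) (fun _ _ => rfl) hw hlo.2 hmin
  have hJD := mem_iff_lt_card hD
  have hJS := mem_iff_lt_card hS
  have hJ := mem_iff_lt_card hUW
  have hdS := finrank_sup_of_mem_stratum hx
  rw [card_jumps] at hJD hJS
  have hDd : Module.finrank K (x.U.space ⊓ x.W.space : Submodule K V) = d := hx
  rw [hDd] at hJD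
  have hsub : JU ∪ JW ⊆ jumps v (x.U.space ⊔ x.W.space) :=
    Finset.union_subset (jumps_mono le_sup_left) (jumps_mono le_sup_right)
  -- As JU ∪ JW is an initial segment, both subspaces lie in the corresponding F_m, so the sum has
  -- no jumps beyond JU ∪ JW.
  have hle : x.U.space ⊔ x.W.space ≤ coordFlag v (JU ∪ JW).card := by
    refine sup_le ?_ ?_
    · exact le_coordFlag_of_forall_jumps_lt fun a ha =>
        (hJ a).1 (Finset.mem_union_left _ ha)
    · exact le_coordFlag_of_forall_jumps_lt fun a ha =>
        (hJ a).1 (Finset.mem_union_right _ ha)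
  have hSc : jumps v (x.U.space ⊔ x.W.space) = JU ∪ JW := by
    refine Finset.Subset.antisymm (fun a ha => ?_) hsub
    rw [hJ]
    have := jumps_mono hle ha
    rw [jumps_coordFlag] at this
    simpa using this
  have hcU : JU.card = k := (card_jumps _).trans x.U.finrank_space
  have hcW : JW.card = l := (card_jumps _).trans x.W.finrank_space
  have hcS : (JU ∪ JW).card + d = k + l := by rw [← hSc, card_jumps, hdS]
  have hcI : (JU ∩ JW).card = d := by
    have := Finset.card_union_add_card_inter JU JW
    omega
  have hDsub : jumps v (x.U.space ⊓ x.W.space) ⊆ JU ∩ JW :=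
    Finset.subset_inter (jumps_mono inf_le_left) (jumps_mono inf_le_right)
  have hDc : jumps v (x.U.space ⊓ x.W.space) = JU ∩ JW := by
    refine Finset.eq_of_subset_of_card_le hDsub ?_
    rw [hcI, card_jumps, hDd]
  constructor
  · intro a
    rw [← Finset.mem_inter, ← hDc, hJD]
  · intro a
    rw [← Finset.mem_union, ← hSc, hJS]
    omega

/-! ### Cells with prescribed jumps -/

variable (v k l) in
/-- The set of pairs of subspaces with prescribed sets of jumps. -/
def cell (A A' : Finset (Fin n)) : Set (X K V k l) :=
  {x | jumps v x.U.space = A ∧ jumps v x.W.space = A'}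

theorem orbit_subset_cell (x : X K V k l) : MulAction.orbit (borelSubgroup v) x ⊆
    cell k l v (jumps v x.U.space) (jumps v x.W.space) := by
  intro y hy
  obtain ⟨b, hb, rfl⟩ := mem_borel_orbit_iff.1 hy
  exact ⟨jumps_map_borel hb _, jumps_map_borel hb _⟩

/-- All members are B-conjugate to the same pair of coordinate subspaces. -/
theorem cell_eq_orbit {A A' : Finset (Fin n)} {d : ℕ} (h : ∀ a, a ∈ A ∧ a ∈ A' ↔ (a : ℕ) < d)
    {x : X K V k l} (hx : x ∈ cell k l v A A') :
    cell k l v A A' = MulAction.orbit (borelSubgroup v) x := by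
  obtain ⟨rfl, rfl⟩ := hx
  refine Set.Subset.antisymm ?_ (orbit_subset_cell x)
  rintro y ⟨hyU, hyW⟩
  obtain ⟨g, hg, hgU, hgW⟩ := exists_borel_map_coordSpan h
  rw [← hyU, ← hyW] at h
  obtain ⟨g', hg', hgU', hgW'⟩ := exists_borel_map_coordSpan h
  rw [hyU] at hgU'
  rw [hyW] at hgW'
  refine mem_borel_orbit_iff.2 ⟨g' * g⁻¹, mul_mem hg' (inv_mem hg), ?_⟩
  let c : X K V k l :=
    ⟨⟨coordSpan v (jumps v x.U.space),
      (finrank_coordSpan _).trans ((card_jumps _).trans x.U.finrank_space)⟩,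
    ⟨coordSpan v (jumps v x.W.space),
      (finrank_coordSpan _).trans ((card_jumps _).trans x.W.finrank_space)⟩⟩
  have hx : g • c = x := X.ext (Gr.ext hgU) (Gr.ext hgW)
  have hy : g' • c = y := X.ext (Gr.ext hgU') (Gr.ext hgW')
  rw [mul_smul, inv_smul_eq_iff.2 hx.symm, hy]

theorem cell_nonempty {A A' : Finset (Fin n)} (hA : A.card = k) (hA' : A'.card = l) :
    (cell k l v A A').Nonempty :=
  ⟨⟨⟨coordSpan v A, (finrank_coordSpan A).trans hA⟩,
    ⟨coordSpan v A', (finrank_coordSpan A').trans hA'⟩⟩,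
    jumps_coordSpan A, jumps_coordSpan A'⟩

theorem isSchubertCell_jumps {A : Finset (Fin n)} (hA : A.card = k) :
    IsSchubertCell v {U : Gr K V k | jumps v U.space = A} := by
  refine ⟨⟨coordSpan v A, (finrank_coordSpan A).trans hA⟩, ?_⟩
  apply Set.Subset.antisymm
  · intro U hU
    -- With zero as second subspace there are no common jumps, and the statement on pairs gives the
    -- one on a single subspace.
    obtain ⟨g, hg, hgU, -⟩ := exists_borel_map_coordSpan (v := v) (U := U.space) (W := ⊥) (d := 0)
      (fun a => by
        simp only [Nat.not_lt_zero, iff_false, not_and]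
        intro _ h
        obtain ⟨x, hx, hxa⟩ := mem_jumps.1 h
        exact hxa.ne_zero hx)
    rw [show jumps v U.space = A from hU] at hgU
    exact ⟨⟨g, hg⟩, Gr.ext hgU⟩
  · rintro _ ⟨g, rfl⟩
    exact (jumps_map_borel g.2 _).trans (jumps_coordSpan A)

/-- The union condition bounds dim (U + W) by k + l - d and the intersection condition bounds dim (U
∩ W) by d. The two dimensions add up to k + l, so both bounds are attained. -/
theorem cell_subset_stratum {A A' : Finset (Fin n)} {d : ℕ} (h : IsAdapted A A' d (k + l - d))
    (hd : d ≤ k) (hn : k + l ≤ n + d) : cell k l v A A' ⊆ stratum K V k l d := by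
  rintro x ⟨rfl, rfl⟩
  have hfin : Module.Finite K V := Module.Finite.of_basis v
  have hsum := Submodule.finrank_sup_add_finrank_inf_eq x.U.space x.W.space
  rw [Gr.finrank_space, Gr.finrank_space] at hsum
  have hS : x.U.space ⊔ x.W.space ≤ coordFlag v (k + l - d) :=
    sup_le (le_coordFlag_of_forall_jumps_lt fun a ha => (h.union a).1 (Or.inl ha))
      (le_coordFlag_of_forall_jumps_lt fun a ha => (h.union a).1 (Or.inr ha))
  have hS' := Submodule.finrank_mono hS
  rw [← card_jumps (v := v) (coordFlag v (k + l - d)), jumps_coordFlag,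
    card_filter_lt (by omega)] at hS'
  have hD : jumps v (x.U.space ⊓ x.W.space) ⊆ Finset.univ.filter fun a : Fin n => (a : ℕ) < d :=
    fun a ha => by
      rw [Finset.mem_filter, ← h.inter]
      exact ⟨Finset.mem_univ a, jumps_mono inf_le_left ha, jumps_mono inf_le_right ha⟩
  have hD' := Finset.card_le_card hD
  rw [card_jumps, Fin.card_filter_val_lt] at hD'
  have := min_le_right n d
  change Module.finrank K (x.U.space ⊓ x.W.space : Submodule K V) = d
  omega

/-! ### Adapted cells: closedness in X_d, minimality, enumeration -/

theorem eq_of_forall_card_filter_eq {J A : Finset (Fin n)}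
    (h : ∀ j : ℕ, (J.filter fun a : Fin n => (a : ℕ) < j).card =
      (A.filter fun a : Fin n => (a : ℕ) < j).card) : J = A := by
  have key : ∀ (J : Finset (Fin n)) (a : Fin n),
      (J.filter fun b : Fin n => (b : ℕ) < a + 1).card =
        (J.filter fun b : Fin n => (b : ℕ) < a).card + if a ∈ J then 1 else 0 := by
    intro J a
    split_ifs with ha
    · have : (J.filter fun b : Fin n => (b : ℕ) < a + 1) =
          insert a (J.filter fun b : Fin n => (b : ℕ) < a) := by
        ext b
        simp only [Finset.mem_filter, Finset.mem_insert, Fin.ext_iff]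
        constructor
        · rintro ⟨hb, hlt⟩
          by_cases hba : (b : ℕ) = a
          · exact Or.inl hba
          · exact Or.inr ⟨hb, by omega⟩
        · rintro (hb | ⟨hb, hlt⟩)
          · exact ⟨(Fin.ext hb : b = a) ▸ ha, by omega⟩
          · exact ⟨hb, by omega⟩
      rw [this, Finset.card_insert_of_notMem (by simp)]
    · rw [add_zero]
      congr 1
      ext b
      simp only [Finset.mem_filter]
      refine and_congr_right fun hb => ?_
      have : (b : ℕ) ≠ a := fun hba => ha ((Fin.ext hba : b = a) ▸ hb)
      omega
  ext a
  have h1 := h (a + 1)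
  rw [key, key, h a] at h1
  by_cases hJ : a ∈ J <;> by_cases hA : a ∈ A <;> simp_all

variable (v k l) in
/-- The closed set of pairs of subspaces in at least as special position to the flag as the
members of `cell k l v A A'`. -/
def closedCell (A A' : Finset (Fin n)) : Set (X K V k l) :=
  ⋂ j : ℕ, {x | (A.filter fun a : Fin n => (a : ℕ) < j).card ≤
      Module.finrank K (x.U.space ⊓ coordFlag v j : Submodule K V)} ∩
    {x | (A'.filter fun a : Fin n => (a : ℕ) < j).card ≤
      Module.finrank K (x.W.space ⊓ coordFlag v j : Submodule K V)}

theorem isClosed_closedCell (A A' : Finset (Fin n)) : IsClosed (closedCell k l v A A') := by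
  have hfin : Module.Finite K V := Module.Finite.of_basis v
  exact isClosed_iInter fun j =>
    (isClosed_le_finrank_inf_left _ _).inter (isClosed_le_finrank_inf_right _ _)

theorem mem_closedCell_iff {A A' : Finset (Fin n)} {x : X K V k l} :
    x ∈ closedCell k l v A A' ↔ ∀ j : ℕ,
      (A.filter fun a : Fin n => (a : ℕ) < j).card ≤
        ((jumps v x.U.space).filter fun a : Fin n => (a : ℕ) < j).card ∧
      (A'.filter fun a : Fin n => (a : ℕ) < j).card ≤
        ((jumps v x.W.space).filter fun a : Fin n => (a : ℕ) < j).card := by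
  simp only [closedCell, Set.mem_iInter, Set.mem_inter_iff, Set.mem_ofPred_eq,
    finrank_inf_coordFlag]

theorem cell_subset_closedCell (A A' : Finset (Fin n)) :
    cell k l v A A' ⊆ closedCell k l v A A' := by
  rintro x ⟨rfl, rfl⟩
  exact mem_closedCell_iff.2 fun j => ⟨le_rfl, le_rfl⟩

/-- The inequality at j = d puts F_d inside both subspaces, and the one at j = k + l - d puts both
inside F_{k+l-d}; on X_d this gives U ∩ W = F_d. The resulting upper bound on dim (U ∩ F_j) + dim (W
∩ F_j) equals the sum of the two lower bounds, so every inequality is an equality. -/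
theorem mem_cell_of_mem_closedCell {A A' : Finset (Fin n)} {d : ℕ}
    (h : IsAdapted A A' d (k + l - d)) (hA : A.card = k) (hA' : A'.card = l) (hdn : d ≤ n)
    {x : X K V k l} (hx : x ∈ closedCell k l v A A') (hxd : x ∈ stratum K V k l d) :
    x ∈ cell k l v A A' := by
  have hfin : Module.Finite K V := Module.Finite.of_basis v
  rw [mem_closedCell_iff] at hx
  have hlow : ∀ (A J : Finset (Fin n)), (∀ a : Fin n, (a : ℕ) < d → a ∈ A) →
      (A.filter fun a : Fin n => (a : ℕ) < d).card ≤
        (J.filter fun a : Fin n => (a : ℕ) < d).card → ∀ a : Fin n, (a : ℕ) < d → a ∈ J := by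
    intro A J hA hle a ha
    have hsub : (J.filter fun a : Fin n => (a : ℕ) < d) ⊆
        A.filter fun a : Fin n => (a : ℕ) < d := fun b hb => by
      rw [Finset.mem_filter] at hb ⊢
      exact ⟨hA b hb.2, hb.2⟩
    have heq := Finset.eq_of_subset_of_card_le hsub hle
    have : a ∈ A.filter fun a : Fin n => (a : ℕ) < d := Finset.mem_filter.2 ⟨hA a ha, ha⟩
    rw [← heq] at this
    exact (Finset.mem_filter.1 this).1
  have hhigh : ∀ (A J : Finset (Fin n)), (∀ a ∈ A, (a : ℕ) < k + l - d) → J.card ≤ A.card →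
      (A.filter fun a : Fin n => (a : ℕ) < k + l - d).card ≤
        (J.filter fun a : Fin n => (a : ℕ) < k + l - d).card →
      ∀ a ∈ J, (a : ℕ) < k + l - d := by
    intro A J hA hcard hle a ha
    rw [Finset.filter_true_of_mem hA] at hle
    have heq := Finset.eq_of_subset_of_card_le (Finset.filter_subset _ J) (hcard.trans hle)
    rw [← heq] at ha
    exact (Finset.mem_filter.1 ha).2
  have hcU : (jumps v x.U.space).card = k := (card_jumps _).trans x.U.finrank_space
  have hcW : (jumps v x.W.space).card = l := (card_jumps _).trans x.W.finrank_space
  have hdU : coordFlag v d ≤ x.U.space := coordFlag_le_of_forall_mem_jumps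
    (hlow A _ (fun a ha => ((h.inter a).2 ha).1) (hx d).1)
  have hdW : coordFlag v d ≤ x.W.space := coordFlag_le_of_forall_mem_jumps
    (hlow A' _ (fun a ha => ((h.inter a).2 ha).2) (hx d).2)
  have hmU : x.U.space ≤ coordFlag v (k + l - d) := le_coordFlag_of_forall_jumps_lt
    (hhigh A _ (fun a ha => (h.union a).1 (Or.inl ha)) (by omega) (hx _).1)
  have hmW : x.W.space ≤ coordFlag v (k + l - d) := le_coordFlag_of_forall_jumps_lt
    (hhigh A' _ (fun a ha => (h.union a).1 (Or.inr ha)) (by omega) (hx _).2)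
  have hD : coordFlag v d = x.U.space ⊓ x.W.space := by
    refine Submodule.eq_of_le_of_finrank_eq (le_inf hdU hdW) ?_
    rw [← card_jumps (v := v) (coordFlag v d), jumps_coordFlag, card_filter_lt hdn]
    exact hxd.symm
  -- Compare the sum and the intersection of U ∩ F_j and W ∩ F_j with F_{k+l-d} ∩ F_j and F_d ∩ F_j;
  -- adaptedness identifies the latter dimensions with the counts of A ∪ A' and A ∩ A'.
  have hsum : ∀ j : ℕ, ((jumps v x.U.space).filter fun a : Fin n => (a : ℕ) < j).card +
      ((jumps v x.W.space).filter fun a : Fin n => (a : ℕ) < j).card ≤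
      (A.filter fun a : Fin n => (a : ℕ) < j).card +
      (A'.filter fun a : Fin n => (a : ℕ) < j).card := by
    intro j
    rw [← finrank_inf_coordFlag, ← finrank_inf_coordFlag,
      ← Submodule.finrank_sup_add_finrank_inf_eq, ← Finset.card_union_add_card_inter]
    refine add_le_add ?_ ?_
    · have hle : x.U.space ⊓ coordFlag v j ⊔ x.W.space ⊓ coordFlag v j ≤
          coordFlag v (k + l - d) ⊓ coordFlag v j :=
        sup_le (inf_le_inf_right _ hmU) (inf_le_inf_right _ hmW)
      refine (Submodule.finrank_mono hle).trans ?_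
      rw [finrank_inf_coordFlag, jumps_coordFlag]
      refine Finset.card_le_card fun a ha => ?_
      simp only [Finset.mem_filter, Finset.mem_univ, true_and, Finset.mem_union] at ha ⊢
      exact ((h.union a).2 ha.1).imp (fun h => ⟨h, ha.2⟩) fun h => ⟨h, ha.2⟩
    · have hle : x.U.space ⊓ coordFlag v j ⊓ (x.W.space ⊓ coordFlag v j) ≤
          coordFlag v d ⊓ coordFlag v j := by
        rw [hD]
        exact le_inf (inf_le_inf inf_le_left inf_le_left) (inf_le_left.trans inf_le_right)
      refine (Submodule.finrank_mono hle).trans ?_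
      rw [finrank_inf_coordFlag, jumps_coordFlag]
      refine Finset.card_le_card fun a ha => ?_
      simp only [Finset.mem_filter, Finset.mem_univ, true_and, Finset.mem_inter] at ha ⊢
      exact ⟨⟨((h.inter a).2 ha.1).1, ha.2⟩, ⟨((h.inter a).2 ha.1).2, ha.2⟩⟩
  constructor
  · refine eq_of_forall_card_filter_eq fun j => ?_
    have h1 := hx j
    have h2 := hsum j
    omega
  · refine eq_of_forall_card_filter_eq fun j => ?_
    have h1 := hx j
    have h2 := hsum j
    omega

theorem isClosed_preimage_cell {A A' : Finset (Fin n)} {d : ℕ}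
    (h : IsAdapted A A' d (k + l - d)) (hA : A.card = k) (hA' : A'.card = l) (hdn : d ≤ n) :
    IsClosed (Subtype.val ⁻¹' cell k l v A A' : Set (stratum K V k l d)) := by
  have : (Subtype.val ⁻¹' cell k l v A A' : Set (stratum K V k l d)) =
      Subtype.val ⁻¹' closedCell k l v A A' := by
    ext x
    exact ⟨fun hx => cell_subset_closedCell _ _ hx,
      fun hx => mem_cell_of_mem_closedCell h hA hA' hdn hx x.2⟩
  rw [this]
  exact (isClosed_closedCell A A').preimage continuous_subtype_val

theorem subset_foldl_minimalParabolic (L : List (Fin (n - 1))) (Z : Set (X K V k l)) :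
    Z ⊆ L.foldl (fun Z i => minimalParabolic v i • Z) Z := by
  induction L generalizing Z with
  | nil => exact subset_rfl
  | cons i L ih =>
    refine Set.Subset.trans ?_ (ih _)
    intro z hz
    exact ⟨1, Or.inl (one_mem _), z, hz, one_smul _ z⟩

theorem foldl_minimalParabolic_subset {T : Set (X K V k l)}
    (hT : ∀ (g : V ≃ₗ[K] V), ∀ z ∈ T, g • z ∈ T) (L : List (Fin (n - 1))) {Z : Set (X K V k l)}
    (hZ : Z ⊆ T) : L.foldl (fun Z i => minimalParabolic v i • Z) Z ⊆ T := by
  induction L generalizing Z with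
  | nil => exact hZ
  | cons i L ih =>
    refine ih ?_
    rintro _ ⟨g, -, z, hz, rfl⟩
    exact hT g z (hZ hz)

theorem finrank_inf_smul (g : V ≃ₗ[K] V) (x : X K V k l) :
    Module.finrank K ((g • x).U.space ⊓ (g • x).W.space : Submodule K V) =
      Module.finrank K (x.U.space ⊓ x.W.space : Submodule K V) := by
  rw [smul_U, smul_W, smul_space, smul_space, ← Submodule.map_inf _ g.injective]
  exact LinearEquiv.finrank_map_eq g _

/-- An orbit below the cell lies in its closure, so dim (U ∩ W) is at least d there. The cell in
turn is reached from the closure of that orbit by group elements, so this dimension is at most d.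
Closedness of the cell in X_d finishes. -/
theorem isMinimalOrbit_cell {A A' : Finset (Fin n)} {d : ℕ}
    (h : IsAdapted A A' d (k + l - d)) (hA : A.card = k) (hA' : A'.card = l) (hd : d ≤ k)
    (hn : k + l ≤ n + d) (hdn : d ≤ n) : IsMinimalOrbit v (cell k l v A A') := by
  have hfin : Module.Finite K V := Module.Finite.of_basis v
  obtain ⟨x, hx⟩ := cell_nonempty (v := v) hA hA'
  refine ⟨⟨x, cell_eq_orbit h.inter hx⟩, ?_⟩
  rintro _ ⟨y, rfl⟩ ⟨L, hL⟩
  have hstr := cell_subset_stratum (v := v) h hd hn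
  have hycl : y ∈ closure (cell k l v A A') := by
    rw [hL]
    exact subset_foldl_minimalParabolic _ _ (subset_closure (MulAction.mem_orbit_self y))
  have h1 : d ≤ Module.finrank K (y.U.space ⊓ y.W.space : Submodule K V) :=
    closure_minimal (fun z hz => (hstr hz).ge) (isClosed_le_finrank_inf d) hycl
  -- The pairs whose intersection is at least as large as that of y form a closed set stable under
  -- GL(V), which therefore contains everything obtained from the closure of the orbit of y.
  have h2 : Module.finrank K (y.U.space ⊓ y.W.space : Submodule K V) ≤
      Module.finrank K (x.U.space ⊓ x.W.space : Submodule K V) := by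
    have hxcl : x ∈ closure (cell k l v A A') := subset_closure hx
    rw [hL] at hxcl
    refine foldl_minimalParabolic_subset (T := {z : X K V k l |
      Module.finrank K (y.U.space ⊓ y.W.space : Submodule K V) ≤
        Module.finrank K (z.U.space ⊓ z.W.space : Submodule K V)}) (fun g z hz => ?_) L
      (closure_minimal ?_ (isClosed_le_finrank_inf _)) hxcl
    · exact hz.trans (finrank_inf_smul g z).ge
    · intro z hz
      obtain ⟨b, -, rfl⟩ := mem_borel_orbit_iff.1 hz
      exact (finrank_inf_smul b y).ge
  have hyd : y ∈ stratum K V k l d := le_antisymm (h2.trans (hstr hx).le) h1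
  have hy : y ∈ cell k l v A A' := mem_cell_of_mem_closedCell h hA hA' hdn
    (closure_minimal (cell_subset_closedCell A A') (isClosed_closedCell A A') hycl) hyd
  exact (cell_eq_orbit h.inter hy).symm

/-- The minimal orbits in `X_d`. -/
theorem isMinimalOrbit_iff [IsAlgClosed K] {d : ℕ} (hdk : d ≤ k)
    (hn : k + l ≤ n + d) (hdn : d ≤ n) {O : Set (X K V k l)} :
    IsMinimalOrbit v O ∧ O ⊆ stratum K V k l d ↔
      ∃ A A' : Finset (Fin n), IsAdapted A A' d (k + l - d) ∧ A.card = k ∧ A'.card = l ∧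
        O = cell k l v A A' := by
  constructor
  · rintro ⟨hO, hOd⟩
    obtain ⟨x, rfl⟩ := hO.1
    have had := isAdapted_of_isMinimalOrbit (hOd (MulAction.mem_orbit_self x)) hO
    exact ⟨_, _, had, (card_jumps _).trans x.U.finrank_space,
      (card_jumps _).trans x.W.finrank_space, (cell_eq_orbit had.inter ⟨rfl, rfl⟩).symm⟩
  · rintro ⟨A, A', h, hA, hA', rfl⟩
    exact ⟨isMinimalOrbit_cell h hA hA' hdk hn hdn, cell_subset_stratum h hdk hn⟩

theorem ncard_minimalOrbits [IsAlgClosed K] {d : ℕ} (hdk : d ≤ k) (hdl : d ≤ l)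
    (hn : k + l ≤ n + d) (hdn : d ≤ n) :
    {O : Set (X K V k l) | IsMinimalOrbit v O ∧ O ⊆ stratum K V k l d}.ncard =
      (k + l - 2 * d).choose (k - d) := by
  classical
  let low : Finset (Fin n) := Finset.univ.filter fun a => (a : ℕ) < d
  let mid : Finset (Fin n) := (Finset.univ.filter fun a => (a : ℕ) < k + l - d) \ low
  have hlow : low.card = d := card_filter_lt hdn
  have hmemlow : ∀ a, a ∈ low ↔ (a : ℕ) < d := fun a => by simp [low]
  have hmemmid : ∀ a, a ∈ mid ↔ (a : ℕ) < k + l - d ∧ d ≤ (a : ℕ) := fun a => by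
    simp [mid, hmemlow]
  have hmid : mid.card = k + l - 2 * d := by
    rw [Finset.card_sdiff_of_subset, hlow, card_filter_lt (by omega)]
    · omega
    · intro a ha
      rw [hmemlow] at ha
      rw [Finset.mem_filter]
      exact ⟨Finset.mem_univ a, by omega⟩
  -- The first d positions go to both sets; the next k + l - 2d are distributed between them, k - d
  -- to the first.
  let f : Finset (Fin n) → Set (X K V k l) := fun I => cell k l v (low ∪ I) (low ∪ (mid \ I))
  have hcards : ∀ I ∈ Finset.powersetCard (k - d) mid,
      (low ∪ I).card = k ∧ (low ∪ (mid \ I)).card = l := by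
    intro I hI
    rw [Finset.mem_powersetCard] at hI
    have hdis : ∀ J ⊆ mid, Disjoint low J := fun J hJ =>
      Finset.disjoint_left.2 fun a ha haJ => by
        have h1 := (hmemlow a).1 ha
        have h2 := ((hmemmid a).1 (hJ haJ)).2
        omega
    rw [Finset.card_union_of_disjoint (hdis I hI.1),
      Finset.card_union_of_disjoint (hdis _ Finset.sdiff_subset),
      Finset.card_sdiff_of_subset hI.1, hlow, hmid, hI.2]
    omega
  have hset : {O : Set (X K V k l) | IsMinimalOrbit v O ∧ O ⊆ stratum K V k l d} =
      f '' (Finset.powersetCard (k - d) mid : Finset (Finset (Fin n))) := by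
    ext O
    rw [Set.mem_ofPred_eq, isMinimalOrbit_iff hdk hn hdn]
    constructor
    · rintro ⟨A, A', h, hA, hA', rfl⟩
      have hlowA : low ⊆ A := fun a ha => ((h.inter a).2 ((hmemlow a).1 ha)).1
      refine ⟨A \ low, ?_, ?_⟩
      · rw [Finset.mem_coe, Finset.mem_powersetCard, Finset.card_sdiff_of_subset hlowA, hA, hlow]
        refine ⟨fun a ha => ?_, rfl⟩
        rw [Finset.mem_sdiff, hmemlow] at ha
        exact (hmemmid a).2 ⟨(h.union a).1 (Or.inl ha.1), not_lt.1 ha.2⟩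
      · have h1 : low ∪ A \ low = A := Finset.union_sdiff_of_subset hlowA
        have h2 : low ∪ (mid \ (A \ low)) = A' := by
          ext a
          have hi := h.inter a
          have hu := h.union a
          simp only [Finset.mem_union, Finset.mem_sdiff, hmemlow, hmemmid]
          grind
        simp only [f, h1, h2]
    · rintro ⟨I, hI, rfl⟩
      rw [Finset.mem_coe] at hI
      refine ⟨_, _, ?_, (hcards I hI).1, (hcards I hI).2, rfl⟩
      have hIm := (Finset.mem_powersetCard.1 hI).1
      constructor
      · intro a
        simp only [Finset.mem_union, Finset.mem_sdiff, hmemlow]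
        have := fun ha => (hmemmid a).1 (hIm ha)
        by_cases haI : a ∈ I
        · simp [haI]
        · simp [haI]
          omega
      · intro a
        simp only [Finset.mem_union, Finset.mem_sdiff, hmemlow, hmemmid]
        have := fun ha => (hmemmid a).1 (hIm ha)
        by_cases haI : a ∈ I
        · have := this haI
          simp only [haI, or_true, true_or, true_iff]
          exact this.1
        · simp only [haI, or_false, not_false_eq_true, and_true]
          omega
  have hinj : Set.InjOn f (Finset.powersetCard (k - d) mid : Finset (Finset (Fin n))) := by
    intro I hI I' hI' hf
    rw [Finset.mem_coe] at hI hI'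
    obtain ⟨x, hx⟩ := cell_nonempty (v := v) (hcards I hI).1 (hcards I hI).2
    have hx' : x ∈ f I' := hf ▸ hx
    have heq : low ∪ I = low ∪ I' := hx.1.symm.trans hx'.1
    ext a
    have h1 := fun ha => (hmemmid a).1 ((Finset.mem_powersetCard.1 hI).1 ha)
    have h2 := fun ha => (hmemmid a).1 ((Finset.mem_powersetCard.1 hI').1 ha)
    have h3 := Finset.ext_iff.1 heq a
    simp only [Finset.mem_union, hmemlow] at h3
    constructor
    · intro ha
      exact (h3.1 (Or.inr ha)).resolve_left (not_lt.2 (h1 ha).2)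
    · intro ha
      exact (h3.2 (Or.inr ha)).resolve_left (not_lt.2 (h2 ha).2)
  rw [hset, hinj.ncard_image, Set.ncard_coe_finset, Finset.card_powersetCard, hmid]

end Cells

end DoubleGrassmannian

namespace DoubleGrassmannian

/-! ### Krull dimension of affine space -/

section AffineSpace

variable (K ι : Type*) [Field K]

/-- The affine space `K^ι` with its Zariski topology. -/
def AffinePoints := ι → K

instance : TopologicalSpace (AffinePoints K ι) := zariskiAffine K (ι → K)

variable {K ι}

theorem mem_polyFun_pi_iff [Finite ι] {f : (ι → K) → K} :
    f ∈ polyFun K (ι → K) ↔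
      ∃ p : MvPolynomial ι K, ∀ x : ι → K, MvPolynomial.aeval x p = f x := by
  classical
  have := Fintype.ofFinite ι
  constructor
  · intro hf
    induction hf using Algebra.adjoin_induction with
    | mem f h =>
      obtain ⟨φ, rfl⟩ := h
      refine ⟨∑ i, MvPolynomial.C (φ (Pi.single i 1)) * MvPolynomial.X i, fun x => ?_⟩
      refine Eq.trans ?_ (LinearMap.pi_apply_eq_sum_univ φ x).symm
      rw [map_sum]
      refine Finset.sum_congr rfl fun i _ => ?_
      simp only [map_mul, MvPolynomial.aeval_X, smul_eq_mul, MvPolynomial.algHom_C,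
        Algebra.algebraMap_self, RingHom.id_apply]
      rw [mul_comm]
      congr 2
      ext j
      simp [Pi.single_apply, eq_comm]
    | algebraMap r => exact ⟨MvPolynomial.C r, fun x => by simp⟩
    | add f g _ _ hf hg =>
      obtain ⟨p, hp⟩ := hf
      obtain ⟨q, hq⟩ := hg
      exact ⟨p + q, fun x => by rw [map_add, hp, hq, Pi.add_apply]⟩
    | mul f g _ _ hf hg =>
      obtain ⟨p, hp⟩ := hf
      obtain ⟨q, hq⟩ := hg
      exact ⟨p * q, fun x => by rw [map_mul, hp, hq, Pi.mul_apply]⟩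
  · rintro ⟨p, hp⟩
    obtain rfl : (fun x => MvPolynomial.aeval x p) = f := funext hp
    clear hp
    induction p using MvPolynomial.induction_on with
    | C a => simpa using const_mem_polyFun a
    | add p q hp hq => 
      simp_rw [map_add]
      exact add_mem hp hq
    | mul_X p i hp => 
      simp_rw [map_mul, MvPolynomial.aeval_X]
      exact mul_mem hp (dual_mem_polyFun (K := K) (E := ι → K) (LinearMap.proj i))

/-- The zero set of an ideal in affine space. -/
def zeroSet (I : Ideal (MvPolynomial ι K)) : Set (AffinePoints K ι) :=
  MvPolynomial.zeroLocus K I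

/-- The ideal of a subset of affine space. -/
def idealOf (Z : Set (AffinePoints K ι)) : Ideal (MvPolynomial ι K) :=
  MvPolynomial.vanishingIdeal K (σ := ι) (K := K) Z

theorem mem_zeroSet {I : Ideal (MvPolynomial ι K)} {x : AffinePoints K ι} :
    x ∈ zeroSet I ↔ ∀ p ∈ I, MvPolynomial.aeval (x : ι → K) p = 0 := Iff.rfl

theorem zeroSet_anti {I J : Ideal (MvPolynomial ι K)} (h : I ≤ J) : zeroSet J ⊆ zeroSet I :=
  fun _ hx p hp => hx p (h hp)

theorem idealOf_anti {Z Z' : Set (AffinePoints K ι)} (h : Z ⊆ Z') : idealOf Z' ≤ idealOf Z :=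
  fun _ hp x hx => hp x (h hx)

theorem idealOf_zeroSet [Finite ι] [IsAlgClosed K] (I : Ideal (MvPolynomial ι K)) [I.IsPrime] :
    idealOf (zeroSet I) = I :=
  MvPolynomial.IsPrime.vanishingIdeal_zeroLocus (K := K) I

theorem isClosed_affinePoints_iff [Finite ι] {Z : Set (AffinePoints K ι)} :
    IsClosed Z ↔
      zeroSet (idealOf Z) = Z := by
  refine (isClosed_zariskiAffine_iff (K := K) (E := ι → K)).trans
    ⟨fun h => ?_, fun h x hx => ?_⟩
  · refine Set.Subset.antisymm (fun x hx => ?_) (fun x hx _ hp => hp x hx)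
    by_contra hxZ
    obtain ⟨f, hf, hfx, hfZ⟩ := h x hxZ
    obtain ⟨p, hp⟩ := mem_polyFun_pi_iff.1 hf
    exact hfx ((hp x).symm.trans (hx p fun y hy => (hp y).trans (hfZ y hy)))
  · rw [← h] at hx
    replace hx := mt mem_zeroSet.2 hx
    simp only [not_forall] at hx
    obtain ⟨p, hp, hpx⟩ := hx
    exact ⟨_, mem_polyFun_pi_iff.2 ⟨p, fun _ => rfl⟩, hpx, fun y hy => hp y hy⟩

theorem isClosed_zeroSet [Finite ι] (I : Ideal (MvPolynomial ι K)) :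
    IsClosed (zeroSet I) :=
  isClosed_affinePoints_iff.2 <| Set.Subset.antisymm
    (zeroSet_anti fun p hp _ hx => hx p hp)
    (fun x hx _ hp => hp x hx)

/-- If pq vanishes on Z, then Z is covered by the hypersurfaces p = 0 and q = 0, and irreducibility
puts it in one of them. -/
theorem isPrime_idealOf [Finite ι] {Z : Set (AffinePoints K ι)} (hZ : IsIrreducible Z) :
    (idealOf Z).IsPrime := by
  refine ⟨fun h => ?_, fun {p q} hpq => ?_⟩
  · obtain ⟨x, hx⟩ := hZ.nonempty
    have h1 : (1 : MvPolynomial ι K) ∈ idealOf Z :=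
      h ▸ Submodule.mem_top
    simpa using h1 x hx
  · have hmem : ∀ (p : MvPolynomial ι K) (x : AffinePoints K ι),
        x ∈ zeroSet (Ideal.span {p}) ↔ MvPolynomial.aeval (x : ι → K) p = 0 := by
      intro p x
      rw [zeroSet, MvPolynomial.zeroLocus_span]
      exact ⟨fun h => h p rfl, fun h q hq => (Set.mem_singleton_iff.1 hq) ▸ h⟩
    have key : ∀ p : MvPolynomial ι K, Z ⊆ zeroSet (Ideal.span {p}) ↔ p ∈ idealOf Z :=
      fun p => forall₂_congr fun x _ => hmem p x
    rw [← key, ← key]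
    refine isPreirreducible_iff_isClosed_union_isClosed.1 hZ.isPreirreducible _ _
      (isClosed_zeroSet _) (isClosed_zeroSet _) fun x hx => ?_
    have h := hpq x hx
    rw [map_mul] at h
    exact (mul_eq_zero.1 h).imp (hmem p x).2 (hmem q x).2

theorem isIrreducible_zeroSet [Finite ι] [IsAlgClosed K] (I : Ideal (MvPolynomial ι K))
    [hI : I.IsPrime] : IsIrreducible (zeroSet I) := by
  have hvan := idealOf_zeroSet I
  constructor
  · rw [Set.nonempty_iff_ne_empty]
    intro h
    rw [h] at hvan
    refine hI.ne_top (hvan.symm.trans ?_)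
    exact MvPolynomial.vanishingIdeal_empty (σ := ι) (K := K)
  · refine isPreirreducible_iff_isClosed_union_isClosed.2 fun Z₁ Z₂ h₁ h₂ hsub => ?_
    by_contra! hne
    obtain ⟨⟨x, hx, hx1⟩, y, hy, hy2⟩ := And.imp Set.not_subset.1 Set.not_subset.1 hne
    rw [← isClosed_affinePoints_iff.1 h₁] at hx1
    rw [← isClosed_affinePoints_iff.1 h₂] at hy2
    simp only [mem_zeroSet, not_forall] at hx1 hy2
    obtain ⟨p, hp, hpx⟩ := hx1
    obtain ⟨q, hq, hqy⟩ := hy2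
    have hpq : p * q ∈ I := by
      rw [← hvan]
      intro z hz
      rw [map_mul]
      rcases hsub hz with h | h
      · rw [hp z h, zero_mul]
      · rw [hq z h, mul_zero]
    rcases hI.mem_or_mem hpq with h | h
    · exact hpx (hx p h)
    · exact hqy (hy q h)

variable (K ι) in
/-- Irreducible closed subsets of affine space correspond to prime ideals. -/
def irreducibleClosedsOrderIso [Finite ι] [IsAlgClosed K] :
    TopologicalSpace.IrreducibleCloseds (AffinePoints K ι) ≃o
      (PrimeSpectrum (MvPolynomial ι K))ᵒᵈ where
  toFun Z := OrderDual.toDual ⟨_, isPrime_idealOf Z.isIrreducible'⟩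
  invFun P := ⟨zeroSet (OrderDual.ofDual P).asIdeal,
    isIrreducible_zeroSet _, isClosed_zeroSet _⟩
  left_inv Z := TopologicalSpace.IrreducibleCloseds.ext (isClosed_affinePoints_iff.1 Z.isClosed')
  right_inv P := by
    refine OrderDual.ofDual.injective (PrimeSpectrum.ext ?_)
    exact idealOf_zeroSet _
  map_rel_iff' {Z Z'} := by
    constructor
    · intro h
      have h' : idealOf Z'.carrier ≤ idealOf Z.carrier := h
      have := zeroSet_anti h'
      rw [isClosed_affinePoints_iff.1 Z.isClosed', isClosed_affinePoints_iff.1 Z'.isClosed'] at this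
      exact this
    · intro h
      exact idealOf_anti (Z := Z.carrier) (Z' := Z'.carrier) h

/-- By the Nullstellensatz, chains of irreducible closed sets are reversed chains of primes in the
polynomial ring. -/
theorem topologicalKrullDim_affinePoints [Finite ι] [IsAlgClosed K] :
    topologicalKrullDim (AffinePoints K ι) = Nat.card ι := by
  rw [topologicalKrullDim, Order.krullDim_eq_of_orderIso (irreducibleClosedsOrderIso K ι),
    Order.krullDim_orderDual]
  have := MvPolynomial.ringKrullDim_of_isNoetherianRing (R := K) (ι := ι)
  rw [ringKrullDim_eq_zero_of_field, zero_add] at this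
  exact this

end AffineSpace

end DoubleGrassmannian

namespace DoubleGrassmannian

/-! ### Rational functions with a fixed denominator -/

section RationalFunctions

variable {K E : Type*} [Field K] [AddCommGroup E] [Module K E]

/-- Functions that become polynomial after multiplication by a power of `D`. -/
def ratFun (D : E → K) (hD : D ∈ polyFun K E) : Subalgebra K (E → K) where
  carrier := {h | ∃ e : ℕ, ∃ F ∈ polyFun K E, ∀ x, D x ≠ 0 → F x = D x ^ e * h x}
  mul_mem' := by
    rintro f g ⟨e, F, hF, hf⟩ ⟨e', G, hG, hg⟩
    refine ⟨e + e', F * G, mul_mem hF hG, fun x hx => ?_⟩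
    rw [Pi.mul_apply, Pi.mul_apply, hf x hx, hg x hx]
    ring
  add_mem' := by
    rintro f g ⟨e, F, hF, hf⟩ ⟨e', G, hG, hg⟩
    refine ⟨e + e', F * D ^ e' + G * D ^ e,
      add_mem (mul_mem hF (pow_mem hD _)) (mul_mem hG (pow_mem hD _)), fun x hx => ?_⟩
    simp only [Pi.add_apply, Pi.mul_apply, Pi.pow_apply, hf x hx, hg x hx]
    ring
  algebraMap_mem' r := ⟨0, _, const_mem_polyFun r, fun x _ => by simp⟩

theorem comp_mem_ratFun {D : E → K} {hD : D ∈ polyFun K E} {ι : Type*} [Fintype ι]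
    {Φ : E → ι → K} (hΦ : ∀ i, (fun x => Φ x i) ∈ ratFun D hD) {f : (ι → K) → K}
    (hf : f ∈ polyFun K (ι → K)) : (fun x => f (Φ x)) ∈ ratFun D hD := by
  obtain ⟨p, hp⟩ := mem_polyFun_pi_iff.1 hf
  obtain rfl : (fun x => MvPolynomial.aeval x p) = f := funext hp
  clear hp hf
  induction p using MvPolynomial.induction_on with
  | C a =>
    simp_rw [MvPolynomial.algHom_C]
    exact (ratFun D hD).algebraMap_mem a
  | add p q hp hq =>
    simp_rw [map_add]
    exact add_mem hp hq
  | mul_X p i hp =>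
    simp_rw [map_mul, MvPolynomial.aeval_X]
    exact mul_mem hp (hΦ i)

end RationalFunctions

/-! ### Normalized frames and reduced echelon forms -/

section Normalization

variable {K V : Type*} [Field K] [AddCommGroup V] [Module K V] {n m : ℕ}
  {v : Module.Basis (Fin n) K V}

variable (v) in
/-- The coordinates of a tuple of vectors at the positions `e`. -/
noncomputable def coordMatrix (e : Fin m → Fin n) (y : Fin m → V) : Matrix (Fin m) (Fin m) K :=
  Matrix.of fun i j => v.repr (y i) (e j)

/-- The linear combinations of a tuple of vectors with coefficients in the rows of a matrix. -/
def combine (G : Matrix (Fin m) (Fin m) K) (y : Fin m → V) : Fin m → V :=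
  fun i => ∑ b, G i b • y b

theorem repr_combine (G : Matrix (Fin m) (Fin m) K) (y : Fin m → V) (i : Fin m) (a : Fin n) :
    v.repr (combine G y i) a = ∑ b, G i b * v.repr (y b) a := by
  simp [combine, Finsupp.finsetSum_apply]

theorem coordMatrix_combine (e : Fin m → Fin n) (G : Matrix (Fin m) (Fin m) K) (y : Fin m → V) :
    coordMatrix v e (combine G y) = G * coordMatrix v e y := by
  ext i j
  exact repr_combine G y i (e j)

variable (v) in
/-- The tuple `y` lies in `L`, and its coordinates at the positions `e` form the unit matrix. -/
def IsNormalized (e : Fin m → Fin n) (L : Submodule K V) (y : Fin m → V) : Prop :=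
  (∀ i, y i ∈ L) ∧ coordMatrix v e y = 1

theorem isNormalized_combine {e : Fin m → Fin n} {u : Fin m → V}
    (h : (coordMatrix v e u).det ≠ 0) : IsNormalized v e (Submodule.span K (Set.range u))
      (combine (coordMatrix v e u)⁻¹ u) := by
  refine ⟨fun i => Submodule.sum_mem _ fun b _ => Submodule.smul_mem _ _
    (Submodule.subset_span ⟨b, rfl⟩), ?_⟩
  rw [coordMatrix_combine, Matrix.nonsing_inv_mul _ (isUnit_iff_ne_zero.2 h)]

/-- Writing y = Gu turns the normalization into G · `coordMatrix v e u` = 1, so the minor is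
invertible and G is its inverse. This gives uniqueness of normalized tuples. -/
theorem IsNormalized.eq_combine {e : Fin m → Fin n} {u y : Fin m → V}
    (h : IsNormalized v e (Submodule.span K (Set.range u)) y) :
    (coordMatrix v e u).det ≠ 0 ∧ y = combine (coordMatrix v e u)⁻¹ u := by
  obtain ⟨hmem, hone⟩ := h
  choose G hG using fun i => (Submodule.mem_span_range_iff_exists_fun K).1 (hmem i)
  obtain rfl : combine (Matrix.of G) u = y := funext hG
  rw [coordMatrix_combine] at hone
  have hdet := congrArg Matrix.det hone
  rw [Matrix.det_mul, Matrix.det_one] at hdet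
  refine ⟨right_ne_zero_of_mul_eq_one hdet, ?_⟩
  rw [Matrix.inv_eq_left_inv hone]

theorem isNormalized_span_iff {e : Fin m → Fin n} {u y : Fin m → V}
    (hone : coordMatrix v e u = 1) :
    IsNormalized v e (Submodule.span K (Set.range u)) y ↔ y = u := by
  constructor
  · intro h
    rw [h.eq_combine.2, hone, inv_one]
    ext i
    simp [combine, Matrix.one_apply]
  · rintro rfl
    exact ⟨fun i => Submodule.subset_span ⟨i, rfl⟩, hone⟩

theorem IsNormalized.repr_eq {e : Fin m → Fin n} {L : Submodule K V} {y : Fin m → V}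
    (h : IsNormalized v e L y) (i j : Fin m) : v.repr (y i) (e j) = if i = j then 1 else 0 := by
  have := congrFun (congrFun h.2 i) j
  rwa [Matrix.one_apply] at this

/-- The leading position is a jump, hence in A, and the only nonzero coordinate of the i-th vector
at positions of A is at `e i`. -/
theorem IsNormalized.lead {A : Finset (Fin n)} {e : Fin m ≃ A} {L : Submodule K V}
    {y : Fin m → V} (h : IsNormalized v (fun i => e i) L y) (hL : jumps v L = A) (i : Fin m) :
    Lead v (y i) (e i) := by
  have h0 : y i ≠ 0 := by
    intro h0
    have := h.repr_eq i i
    simp [h0] at this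
  obtain ⟨a, ha⟩ := exists_lead (v := v) h0
  have haA : a ∈ A := hL ▸ mem_jumps.2 ⟨_, h.1 i, ha⟩
  obtain ⟨j, hj⟩ := e.surjective ⟨a, haA⟩
  have hja : (e j : Fin n) = a := by rw [hj]
  have hne := ha.1
  rw [← hja, h.repr_eq] at hne
  have hij : i = j := by
    by_contra hij
    simp [hij] at hne
  rwa [hij, hja, ← hij]

/-- Projection of L to the coordinates at its jumps is injective between spaces of equal dimension;
the preimages of the unit vectors form the tuple. -/
theorem exists_isNormalized {A : Finset (Fin n)} (e : Fin m ≃ A) {L : Submodule K V}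
    (hL : jumps v L = A) : ∃ y, IsNormalized v (fun i => e i) L y := by
  have hfin : Module.Finite K V := Module.Finite.of_basis v
  let Φ : L →ₗ[K] (Fin m → K) := LinearMap.pi fun i => (v.coord (e i)).comp L.subtype
  have hinj : Function.Injective Φ := by
    rw [injective_iff_map_eq_zero]
    intro x hx
    by_contra h0
    obtain ⟨a, ha⟩ := exists_lead (v := v) (x := (x : V)) (by simpa using h0)
    have haA : a ∈ A := hL ▸ mem_jumps.2 ⟨x, x.2, ha⟩
    obtain ⟨j, hj⟩ := e.surjective ⟨a, haA⟩
    have hxj : v.repr (x : V) (e j) = 0 := congrFun hx j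
    rw [hj] at hxj
    exact ha.1 hxj
  have hdim : Module.finrank K L = Module.finrank K (Fin m → K) := by
    rw [← card_jumps (v := v), hL, Module.finrank_fin_fun, ← Fintype.card_coe,
      ← Fintype.card_congr e, Fintype.card_fin]
  have hsurj := (LinearMap.injective_iff_surjective_of_finrank_eq_finrank hdim).1 hinj
  choose y hy using fun i : Fin m => hsurj (Pi.single i 1)
  refine ⟨fun i => y i, fun i => (y i).2, ?_⟩
  ext i j
  have : v.repr (y i : V) (e j) = (Pi.single i 1 : Fin m → K) j := congrFun (hy i) j
  rw [Matrix.one_apply]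
  refine this.trans ?_
  simp [Pi.single_apply, eq_comm]

variable (v) in
/-- The vectors of a reduced echelon form with prescribed entries. -/
noncomputable def echelon (C : Fin n → Fin n → K) (a : Fin n) : V :=
  v a + ∑ j, if j < a then C a j • v j else 0

theorem repr_echelon (C : Fin n → Fin n → K) (a j : Fin n) : v.repr (echelon v C a) j =
    (if j = a then 1 else 0) + if j < a then C a j else 0 := by
  have : v.repr (∑ j, if j < a then C a j • v j else 0) j = if j < a then C a j else 0 := by
    rw [map_sum, Finsupp.finsetSum_apply, Finset.sum_eq_single j]
    · split_ifs <;> simp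
    · intro b _ hb
      split_ifs <;> simp [hb.symm]
    · simp
  rw [echelon, map_add, Finsupp.add_apply, this, Module.Basis.repr_self, Finsupp.single_apply]
  simp only [eq_comm]

theorem lead_echelon (C : Fin n → Fin n → K) (a : Fin n) : Lead v (echelon v C a) a := by
  refine ⟨by simp [repr_echelon], fun b hb => ?_⟩
  rw [repr_echelon, if_neg hb.ne', if_neg hb.not_gt, add_zero]

theorem eq_echelon {C : Fin n → Fin n → K} {a : Fin n} {x : V} (h1 : v.repr x a = 1)
    (h2 : ∀ j, a < j → v.repr x j = 0) (h3 : ∀ j, j < a → v.repr x j = C a j) :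
    x = echelon v C a := by
  refine v.repr.injective (Finsupp.ext fun j => ?_)
  rw [repr_echelon]
  rcases lt_trichotomy j a with h | h | h
  · rw [if_neg h.ne, if_pos h, h3 j h, zero_add]
  · simp [h, h1]
  · rw [if_neg h.ne', if_neg h.not_gt, h2 j h, zero_add]

theorem coordMatrix_echelon {A : Finset (Fin n)} (e : Fin m ≃ A) {C : Fin n → Fin n → K}
    (hC : ∀ a ∈ A, ∀ b ∈ A, C a b = 0) :
    coordMatrix v (fun i => (e i : Fin n)) (fun i => echelon v C (e i)) = 1 := by
  ext i j
  change v.repr (echelon v C (e i)) (e j) = _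
  rw [repr_echelon, hC _ (e i).2 _ (e j).2, ite_self, add_zero, Matrix.one_apply]
  simp [eq_comm]

theorem linearIndependent_echelon {A : Finset (Fin n)} (e : Fin m ≃ A) (C : Fin n → Fin n → K) :
    LinearIndependent K fun i => echelon v C (e i) :=
  linearIndependent_of_lead (f := fun i => (e i : Fin n))
    (Subtype.val_injective.comp e.injective) fun i => lead_echelon C (e i)

theorem jumps_span_of_lead {A : Finset (Fin n)} {e : Fin m ≃ A} {y : Fin m → V}
    (hy : ∀ i, Lead v (y i) (e i)) : jumps v (Submodule.span K (Set.range y)) = A := by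
  have hli : LinearIndependent K y := linearIndependent_of_lead (f := fun i => (e i : Fin n))
    (Subtype.val_injective.comp e.injective) hy
  refine (Finset.eq_of_subset_of_card_le (fun a ha => ?_) ?_).symm
  · obtain ⟨i, hi⟩ := e.surjective ⟨a, ha⟩
    have := hy i
    rw [hi] at this
    exact mem_jumps.2 ⟨y i, Submodule.subset_span ⟨i, rfl⟩, this⟩
  · rw [card_jumps, finrank_span_eq_card hli, ← Fintype.card_coe, ← Fintype.card_congr e]

variable (v) in
/-- The entries of the normalization of a tuple are rational functions of the tuple. -/
theorem exists_numerator (e : Fin m → Fin n) (i : Fin m) (j : Fin n) :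
    ∃ N ∈ polyFun K (Fin m → V), ∀ u, (coordMatrix v e u).det ≠ 0 →
      N u = (coordMatrix v e u).det * v.repr (combine (coordMatrix v e u)⁻¹ u i) j := by
  have hentry : ∀ (i : Fin m) (a : Fin n),
      (fun u : Fin m → V => v.repr (u i) a) ∈ polyFun K (Fin m → V) := fun i a =>
    dual_mem_polyFun (K := K) (E := Fin m → V) ((v.coord a).comp (LinearMap.proj i))
  refine ⟨fun u => ∑ b, (coordMatrix v e u).adjugate i b * v.repr (u b) j, ?_, ?_⟩
  · have : (fun u : Fin m → V => ∑ b, (coordMatrix v e u).adjugate i b * v.repr (u b) j) =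
        ∑ b, (fun u : Fin m → V => (coordMatrix v e u).adjugate i b) *
          fun u : Fin m → V => v.repr (u b) j := by
      ext u
      simp
    rw [this]
    refine sum_mem fun b _ => mul_mem ?_ (hentry b j)
    simp_rw [Matrix.adjugate_apply]
    refine det_mem_polyFun fun r c => ?_
    by_cases hr : r = b
    · subst hr
      simp_rw [Matrix.updateRow_self]
      exact const_mem_polyFun _
    · simp_rw [Matrix.updateRow_ne hr]
      exact hentry r (e c)
  · intro u hu
    rw [repr_combine, Matrix.inv_def, Finset.mul_sum]
    refine Finset.sum_congr rfl fun b _ => ?_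
    rw [Matrix.smul_apply, Ring.inverse_eq_inv', smul_eq_mul]
    field_simp

end Normalization

/-! ### Parametrization of adapted cells by affine space -/

section Parametrization

variable {K V : Type*} [Field K] [AddCommGroup V] [Module K V] {n k l : ℕ}
  {v : Module.Basis (Fin n) K V} {A A' : Finset (Fin n)}

/-- The positions of the free entries in the reduced echelon forms of the members of a cell. -/
abbrev Positions (A A' : Finset (Fin n)) := ↥((A \ A') ×ˢ (A' \ A))

/-- The extension by zero of a family of entries. -/
def extend (c : Positions A A' → K) (a b : Fin n) : K :=
  if h : (a, b) ∈ (A \ A') ×ˢ (A' \ A) then c ⟨(a, b), h⟩ else 0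

theorem extend_eq_zero_left (c : Positions A A' → K) {a b : Fin n} (hb : b ∈ A) :
    extend c a b = 0 := dif_neg (by simp [hb])

theorem extend_eq_zero_right (c : Positions A A' → K) {a b : Fin n} (ha : a ∈ A') :
    extend c a b = 0 := dif_neg (by simp [ha])

theorem extend_apply (c : Positions A A' → K) (p : Positions A A') :
    extend c p.1.1 p.1.2 = c p := dif_pos p.2

theorem Positions.mem (p : Positions A A') :
    p.1.1 ∈ A ∧ p.1.1 ∉ A' ∧ p.1.2 ∈ A' ∧ p.1.2 ∉ A := by
  have := p.2
  rw [Finset.mem_product, Finset.mem_sdiff, Finset.mem_sdiff] at this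
  exact ⟨this.1.1, this.1.2, this.2.1, this.2.2⟩

theorem extend_mem_polyFun (a b : Fin n) :
    (fun c : Positions A A' → K => extend c a b) ∈ polyFun K (Positions A A' → K) := by
  by_cases h : (a, b) ∈ (A \ A') ×ˢ (A' \ A)
  · simp_rw [extend, dif_pos h]
    exact dual_mem_polyFun (K := K) (E := Positions A A' → K) (LinearMap.proj ⟨(a, b), h⟩)
  · simp_rw [extend, dif_neg h]
    exact const_mem_polyFun 0

theorem dual_echelon_mem_polyFun {E : Type*} [AddCommGroup E] [Module K E]
    {C : E → Fin n → Fin n → K} (hC : ∀ a b, (fun c => C c a b) ∈ polyFun K E)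
    (φ : Module.Dual K V) (a : Fin n) : (fun c => φ (echelon v (C c) a)) ∈ polyFun K E := by
  have : (fun c => φ (echelon v (C c) a)) = (fun _ => φ (v a)) +
      ∑ j, if j < a then (fun c => C c a j) * (fun _ => φ (v j)) else 0 := by
    ext c
    simp only [echelon, map_add, map_sum, Pi.add_apply, Finset.sum_apply]
    congr 1
    refine Finset.sum_congr rfl fun j _ => ?_
    split_ifs <;> simp
  rw [this]
  refine add_mem (const_mem_polyFun _) (sum_mem fun j _ => ?_)
  split_ifs
  · exact mul_mem (hC a j) (const_mem_polyFun _)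
  · exact zero_mem _

variable (v) in
/-- The frames in reduced echelon form. -/
noncomputable def echelonFrames (eU : Fin k ≃ A) (eW : Fin l ≃ A') (c : Positions A A' → K) :
    Frames K V k l where
  u := fun i => echelon v (extend c) (eU i)
  -- The same entries serve both frames, transposed here. As `echelon` reads only positions before
  -- the lead, the entry at (a, b) enters U if b < a and W if a < b.
  w := fun i => echelon v (fun b a => extend c a b) (eW i)
  linearIndependent_u := linearIndependent_echelon eU _
  linearIndependent_w := linearIndependent_echelon eW _

variable (v) in
/-- The parametrization of a cell by an affine space. -/
noncomputable def cellParam (eU : Fin k ≃ A) (eW : Fin l ≃ A') (c : AffinePoints K (Positions A A')) :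
    X K V k l :=
  (echelonFrames v eU eW c).span

variable (v) in
/-- The free entries of a pair of frames in reduced echelon form. -/
noncomputable def entries (eU : Fin k ≃ A) (eW : Fin l ≃ A') (y : Fin k → V) (z : Fin l → V)
    (p : Positions A A') : K :=
  if p.1.2 < p.1.1 then v.repr (y (eU.symm ⟨p.1.1, p.mem.1⟩)) p.1.2
  else v.repr (z (eW.symm ⟨p.1.2, p.mem.2.2.1⟩)) p.1.1

variable {eU : Fin k ≃ A} {eW : Fin l ≃ A'}

theorem entries_echelonFrames (c : Positions A A' → K) :
    entries v eU eW (echelonFrames v eU eW c).u (echelonFrames v eU eW c).w = c := by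
  ext p
  have hp := p.mem
  have hne : p.1.1 ≠ p.1.2 := fun h => hp.2.2.2 (h ▸ hp.1)
  rw [entries]
  split_ifs with h
  · change v.repr (echelon v (extend c) (eU (eU.symm _))) _ = _
    rw [Equiv.apply_symm_apply, repr_echelon, if_neg hne.symm, if_pos h, zero_add, extend_apply]
  · change v.repr (echelon v (fun b a => extend c a b) (eW (eW.symm _))) _ = _
    rw [Equiv.apply_symm_apply, repr_echelon, if_neg hne,
      if_pos (lt_of_le_of_ne (not_lt.1 h) hne), zero_add, extend_apply]

theorem coordMatrix_echelonFrames_u (c : Positions A A' → K) :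
    coordMatrix v (fun i => (eU i : Fin n)) (fun i => echelon v (extend c) (eU i)) = 1 :=
  coordMatrix_echelon eU fun _ _ _ hb => extend_eq_zero_left c hb

theorem coordMatrix_echelonFrames_w (c : Positions A A' → K) :
    coordMatrix v (fun i => (eW i : Fin n))
      (fun i => echelon v (fun b a => extend c a b) (eW i)) = 1 := by
  apply coordMatrix_echelon
  intro _ _ _ hb
  exact extend_eq_zero_right c hb

theorem isNormalized_u_iff (c : Positions A A' → K) {y : Fin k → V} :
    IsNormalized v (fun i => (eU i : Fin n)) (cellParam v eU eW c).U.space y ↔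
      y = (echelonFrames v eU eW c).u :=
  isNormalized_span_iff (coordMatrix_echelonFrames_u c)

theorem isNormalized_w_iff (c : Positions A A' → K) {z : Fin l → V} :
    IsNormalized v (fun i => (eW i : Fin n)) (cellParam v eU eW c).W.space z ↔
      z = (echelonFrames v eU eW c).w :=
  isNormalized_span_iff (coordMatrix_echelonFrames_w c)

variable (v eU eW) in
/-- The pairs of subspaces all of whose normalized frames have entries in the zero locus of `f`. -/
def entryLocus (f : (Positions A A' → K) → K) : Set (X K V k l) :=
  {x | ∀ y z, IsNormalized v (fun i => (eU i : Fin n)) x.U.space y →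
    IsNormalized v (fun i => (eW i : Fin n)) x.W.space z → f (entries v eU eW y z) = 0}

theorem cellParam_mem_entryLocus_iff {f : (Positions A A' → K) → K} (c : Positions A A' → K) :
    cellParam v eU eW c ∈ entryLocus v eU eW f ↔ f c = 0 := by
  constructor
  · intro h
    have := h _ _ ((isNormalized_u_iff c).2 rfl) ((isNormalized_w_iff c).2 rfl)
    rwa [entries_echelonFrames] at this
  · intro h y z hy hz
    rw [(isNormalized_u_iff c).1 hy, (isNormalized_w_iff c).1 hz, entries_echelonFrames, h]

/-- Where both minors of a pair of frames are nonzero, the normalized frames are unique and their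
entries are rational functions of the frames; where one minor vanishes there are no normalized
frames, and the condition is empty. -/
theorem isClosed_entryLocus {f : (Positions A A' → K) → K}
    (hf : f ∈ polyFun K (Positions A A' → K)) : IsClosed (entryLocus v eU eW f) := by
  let E := (Fin k → V) × (Fin l → V)
  let DU : E → K := fun q => (coordMatrix v (fun i => (eU i : Fin n)) q.1).det
  let DW : E → K := fun q => (coordMatrix v (fun i => (eW i : Fin n)) q.2).det
  have hDU : DU ∈ polyFun K E := det_mem_polyFun fun i j =>
    dual_mem_polyFun (K := K) (E := E)
      ((v.coord (eU j)).comp ((LinearMap.proj i).comp (LinearMap.fst K _ _)))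
  have hDW : DW ∈ polyFun K E := det_mem_polyFun fun i j =>
    dual_mem_polyFun (K := K) (E := E)
      ((v.coord (eW j)).comp ((LinearMap.proj i).comp (LinearMap.snd K _ _)))
  have hD : DU * DW ∈ polyFun K E := mul_mem hDU hDW
  let Φ : E → Positions A A' → K := fun q => entries v eU eW
    (combine (coordMatrix v (fun i => (eU i : Fin n)) q.1)⁻¹ q.1)
    (combine (coordMatrix v (fun i => (eW i : Fin n)) q.2)⁻¹ q.2)
  have hΦ : ∀ p, (fun q => Φ q p) ∈ ratFun (DU * DW) hD := by
    intro p
    simp only [Φ, entries]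
    split_ifs with h
    · obtain ⟨N, hN, hNu⟩ := exists_numerator v (fun i => (eU i : Fin n))
        (eU.symm ⟨p.1.1, p.mem.1⟩) p.1.2
      refine ⟨1, DW * fun q => N q.1,
        mul_mem hDW (comp_linear_mem_polyFun (E' := E) (LinearMap.fst K _ _) hN), fun q hq => ?_⟩
      rw [Pi.mul_apply, hNu q.1 (left_ne_zero_of_mul hq), pow_one, Pi.mul_apply]
      simp only [DU]
      ring
    · obtain ⟨N, hN, hNu⟩ := exists_numerator v (fun i => (eW i : Fin n))
        (eW.symm ⟨p.1.2, p.mem.2.2.1⟩) p.1.1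
      refine ⟨1, DU * fun q => N q.2,
        mul_mem hDU (comp_linear_mem_polyFun (E' := E) (LinearMap.snd K _ _) hN), fun q hq => ?_⟩
      rw [Pi.mul_apply, hNu q.2 (right_ne_zero_of_mul hq), pow_one, Pi.mul_apply]
      simp only [DW]
      ring
  obtain ⟨e, F, hF, hFe⟩ := comp_mem_ratFun hΦ hf
  -- F is uncontrolled where a minor vanishes; the extra factor makes the product zero there.
  refine isClosed_X_iff.2 fun p hp => ⟨F * (DU * DW), mul_mem hF hD, ?_, ?_⟩
  · simp only [entryLocus, Set.mem_ofPred_eq, not_forall] at hp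
    obtain ⟨y, z, hy, hz, hne⟩ := hp
    obtain ⟨hu, rfl⟩ := IsNormalized.eq_combine (u := p.u) hy
    obtain ⟨hw, rfl⟩ := IsNormalized.eq_combine (u := p.w) hz
    have hne0 : (DU * DW) (p.u, p.w) ≠ 0 := mul_ne_zero hu hw
    rw [Pi.mul_apply, hFe _ hne0]
    exact mul_ne_zero (mul_ne_zero (pow_ne_zero _ hne0) hne) hne0
  · intro q hq
    rw [Pi.mul_apply]
    by_cases h0 : (DU * DW) (q.u, q.w) = 0
    · rw [h0, mul_zero]
    · rw [hFe _ h0]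
      have : f (Φ (q.u, q.w)) = 0 := hq _ _
        (isNormalized_combine (left_ne_zero_of_mul h0))
        (isNormalized_combine (right_ne_zero_of_mul h0))
      simp only [this, mul_zero, zero_mul]

theorem continuous_cellParam : Continuous (cellParam v eU eW) := by
  refine continuous_iff_isClosed.2 fun T hT =>
    (isClosed_zariskiAffine_iff (K := K) (E := Positions A A' → K)).2 fun c hc => ?_
  obtain ⟨f, hf, hfc, hfT⟩ := isClosed_X_iff.1 hT (echelonFrames v eU eW c) hc
  refine ⟨fun c => f ((echelonFrames v eU eW c).u, (echelonFrames v eU eW c).w),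
    comp_mem_polyFun (fun φ => ?_) hf, hfc, fun c' hc' => hfT _ hc'⟩
  have hsplit : ∀ (u : Fin k → V) (w : Fin l → V), φ (u, w) =
      (∑ i, φ.comp ((LinearMap.inl K _ _).comp (LinearMap.single K _ i)) (u i)) +
        ∑ i, φ.comp ((LinearMap.inr K _ _).comp (LinearMap.single K _ i)) (w i) := by
    intro u w
    have h1 : (u, w) = LinearMap.inl K _ _ u + LinearMap.inr K _ _ w := by simp
    have h2 : ∑ i, LinearMap.single K (fun _ : Fin k => V) i (u i) = u :=
      LinearMap.sum_single_apply _ _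
    have h3 : ∑ i, LinearMap.single K (fun _ : Fin l => V) i (w i) = w :=
      LinearMap.sum_single_apply _ _
    conv_lhs => rw [h1, ← h2, ← h3]
    simp only [map_add, map_sum, LinearMap.comp_apply]
  have heq : (fun c : Positions A A' → K =>
      φ ((echelonFrames v eU eW c).u, (echelonFrames v eU eW c).w)) =
      (∑ i, fun c : Positions A A' → K =>
        φ.comp ((LinearMap.inl K _ _).comp (LinearMap.single K _ i))
          (echelon v (extend c) (eU i))) +
      ∑ i, fun c : Positions A A' → K =>
        φ.comp ((LinearMap.inr K _ _).comp (LinearMap.single K _ i))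
          (echelon v (fun b a => extend c a b) (eW i)) := by
    ext c
    rw [hsplit, Pi.add_apply, Finset.sum_apply, Finset.sum_apply]
    rfl
  rw [heq]
  exact add_mem
    (sum_mem fun i _ => dual_echelon_mem_polyFun extend_mem_polyFun _ _)
    (sum_mem fun i _ => dual_echelon_mem_polyFun (fun a b => extend_mem_polyFun b a) _ _)

/-- Every polynomial condition on the parameters is the pullback of a closed condition on X, its
`entryLocus`, so closed sets of parameters are preimages of closed sets. -/
theorem isEmbedding_cellParam : Topology.IsEmbedding (cellParam v eU eW) := by
  refine ⟨⟨TopologicalSpace.ext_isClosed fun Z => ?_⟩, fun c c' h => ?_⟩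
  · rw [isClosed_induced_iff]
    constructor
    · intro hZ
      refine ⟨⋂ f ∈ {f | f ∈ polyFun K (Positions A A' → K) ∧ ∀ c ∈ Z, f c = 0},
        entryLocus v eU eW f, isClosed_biInter fun f hf => isClosed_entryLocus hf.1, ?_⟩
      ext c
      rw [Set.mem_preimage, Set.mem_iInter₂]
      constructor
      · intro h
        by_contra hc
        obtain ⟨f, hf, hfc, hfZ⟩ :=
          (isClosed_zariskiAffine_iff (K := K) (E := Positions A A' → K)).1 hZ c hc
        exact hfc ((cellParam_mem_entryLocus_iff c).1 (h f ⟨hf, hfZ⟩))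
      · exact fun hc f hf => (cellParam_mem_entryLocus_iff c).2 (hf.2 c hc)
    · rintro ⟨T, hT, rfl⟩
      exact hT.preimage continuous_cellParam
  · funext p
    -- Injectivity: a coordinate of the parameter can be read off from the point.
    have h1 : cellParam v eU eW c ∈ entryLocus v eU eW fun a => a p - c' p := by
      rw [h]
      exact (cellParam_mem_entryLocus_iff c').2 (sub_self _)
    exact sub_eq_zero.1 ((cellParam_mem_entryLocus_iff c).1 h1)

theorem jumps_space_cellParam_U (c : Positions A A' → K) :
    jumps v (cellParam v eU eW c).U.space = A :=
  jumps_span_of_lead (e := eU) (y := (echelonFrames v eU eW c).u)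
    fun i => lead_echelon (extend c) (eU i)

theorem jumps_space_cellParam_W (c : Positions A A' → K) :
    jumps v (cellParam v eU eW c).W.space = A' :=
  jumps_span_of_lead (e := eW) (y := (echelonFrames v eU eW c).w)
    fun i => lead_echelon (fun b a => extend c a b) (eW i)

/-- In the normalized vector with lead a ∈ A, an entry at j < a is forced to vanish if j ∈ A.
Otherwise j ∈ A' because the union is an initial segment, and a ∉ A' because the intersection is
one; so the entry sits at an allowed position. The argument for A' is symmetric. -/
theorem range_cellParam {d m : ℕ} (h : IsAdapted A A' d m) :
    Set.range (cellParam v eU eW) = cell k l v A A' := by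
  have hmem : ∀ {a j : Fin n}, a ∈ A → a ∈ A' → j < a → j ∈ A ∧ j ∈ A' := fun ha ha' hja =>
    (h.inter _).2 (lt_trans (Fin.lt_def.1 hja) ((h.inter _).1 ⟨ha, ha'⟩))
  have hor : ∀ {a j : Fin n}, a ∈ A ∨ a ∈ A' → j < a → j ∈ A ∨ j ∈ A' := fun ha hja =>
    (h.union _).2 (lt_trans (Fin.lt_def.1 hja) ((h.union _).1 ha))
  apply Set.Subset.antisymm
  · rintro _ ⟨c, rfl⟩
    exact ⟨jumps_space_cellParam_U c, jumps_space_cellParam_W c⟩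
  · rintro x ⟨hxU, hxW⟩
    obtain ⟨y, hy⟩ := exists_isNormalized eU hxU
    obtain ⟨z, hz⟩ := exists_isNormalized eW hxW
    let c : Positions A A' → K := entries v eU eW y z
    have hyc : ∀ i, y i = echelon v (extend c) (eU i) := by
      intro i
      refine eq_echelon ?_ (hy.lead hxU i).2 fun j hj => ?_
      · simpa using hy.repr_eq i i
      · by_cases hjA : j ∈ A
        · rw [extend_eq_zero_left c hjA]
          obtain ⟨i', hi'⟩ := eU.surjective ⟨j, hjA⟩
          have := hy.repr_eq i i'
          rw [hi'] at this
          rw [this, if_neg]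
          rintro rfl
          rw [hi'] at hj
          exact lt_irrefl _ hj
        · have hjA' : j ∈ A' := (hor (Or.inl (eU i).2) hj).resolve_left hjA
          have hiA' : (eU i : Fin n) ∉ A' := fun hi => hjA (hmem (eU i).2 hi hj).1
          have hp : ((eU i : Fin n), j) ∈ (A \ A') ×ˢ (A' \ A) := by
            simp [hiA', hjA, hjA']
          rw [extend, dif_pos hp]
          simp only [c, entries, if_pos hj, Subtype.coe_eta, Equiv.symm_apply_apply]
    have hzc : ∀ i, z i = echelon v (fun b a => extend c a b) (eW i) := by
      intro i
      refine eq_echelon ?_ (hz.lead hxW i).2 fun j hj => ?_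
      · simpa using hz.repr_eq i i
      · by_cases hjA' : j ∈ A'
        · rw [extend_eq_zero_right c hjA']
          obtain ⟨i', hi'⟩ := eW.surjective ⟨j, hjA'⟩
          have := hz.repr_eq i i'
          rw [hi'] at this
          rw [this, if_neg]
          rintro rfl
          rw [hi'] at hj
          exact lt_irrefl _ hj
        · have hjA : j ∈ A := (hor (Or.inr (eW i).2) hj).resolve_right hjA'
          have hiA : (eW i : Fin n) ∉ A := fun hi => hjA' (hmem hi (eW i).2 hj).2
          have hp : (j, (eW i : Fin n)) ∈ (A \ A') ×ˢ (A' \ A) := by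
            simp [hiA, hjA, hjA']
          rw [extend, dif_pos hp]
          simp only [c, entries, if_neg hj.not_gt, Subtype.coe_eta, Equiv.symm_apply_apply]
    refine ⟨c, X.ext (Gr.ext ?_) (Gr.ext ?_)⟩
    · refine eq_of_le_of_jumps_subset (v := v) (Submodule.span_le.2 ?_) ?_
      · rintro _ ⟨i, rfl⟩
        have := hy.1 i
        rwa [hyc i] at this
      · exact (hxU.trans (jumps_space_cellParam_U c).symm).subset
    · refine eq_of_le_of_jumps_subset (v := v) (Submodule.span_le.2 ?_) ?_
      · rintro _ ⟨i, rfl⟩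
        have := hz.1 i
        rwa [hzc i] at this
      · exact (hxW.trans (jumps_space_cellParam_W c).symm).subset

theorem topologicalKrullDim_cell [IsAlgClosed K] {d m : ℕ} (h : IsAdapted A A' d m)
    (hA : A.card = k) (hA' : A'.card = l) (hd : d ≤ n) :
    topologicalKrullDim (cell k l v A A') = (((k - d) * (l - d) : ℕ) : WithBot ℕ∞) := by
  let eU : Fin k ≃ A := (A.equivFinOfCardEq hA).symm
  let eW : Fin l ≃ A' := (A'.equivFinOfCardEq hA').symm
  have hemb : Topology.IsEmbedding (cellParam v eU eW) := isEmbedding_cellParam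
  rw [← range_cellParam (v := v) (eU := eU) (eW := eW) h,
    ← hemb.toHomeomorph.isHomeomorph.topologicalKrullDim_eq, topologicalKrullDim_affinePoints]
  have hi : (A ∩ A').card = d := by
    have : A ∩ A' = Finset.univ.filter fun a : Fin n => (a : ℕ) < d := by
      ext a
      rw [Finset.mem_inter, h.inter]
      simp
    rw [this, card_filter_lt hd]
  have hi' : (A' ∩ A).card = d := by rw [Finset.inter_comm, hi]
  have h1 := Finset.card_sdiff_add_card_inter A A'
  have h2 := Finset.card_sdiff_add_card_inter A' A
  rw [Nat.card_eq_fintype_card, Fintype.card_coe, Finset.card_product]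
  congr 3 <;> omega

end Parametrization

end DoubleGrassmannian

namespace DoubleGrassmannian

/-! ### X_d is a nonempty single GL(V)-orbit -/

section SingleOrbit

variable {K V : Type*} [Field K] [AddCommGroup V] [Module K V] {n k l : ℕ}

theorem exists_span_range_eq [Module.Finite K V] {L : Submodule K V} {r : ℕ}
    (h : Module.finrank K L = r) : ∃ f : Fin r → V, Submodule.span K (Set.range f) = L := by
  let b := Module.finBasisOfFinrankEq K L h
  refine ⟨L.subtype ∘ b, ?_⟩
  rw [Set.range_comp, ← Submodule.map_span, b.span_eq, Submodule.map_top, Submodule.range_subtype]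

/-- A basis of `V` adapted to a pair of subspaces. -/
theorem exists_adapted_basis [Module.Finite K V] {d r : ℕ} {x : X K V k l}
    (hx : x ∈ stratum K V k l d) (hr : Module.finrank K V + d = k + l + r) (hdk : d ≤ k)
    (hdl : d ≤ l) : ∃ b : Module.Basis (Fin d ⊕ Fin (k - d) ⊕ Fin (l - d) ⊕ Fin r) K V,
      x.U.space = Submodule.span K (b '' {i | i.isLeft ∨ ∃ j, i = Sum.inr (Sum.inl j)}) ∧
      x.W.space = Submodule.span K
        (b '' {i | i.isLeft ∨ ∃ j, i = Sum.inr (Sum.inr (Sum.inl j))}) := by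
  set U := x.U.space with hU
  set W := x.W.space with hW
  obtain ⟨P, hP⟩ := exists_isCompl (U ⊓ W)
  obtain ⟨C, hC⟩ := exists_isCompl (U ⊔ W)
  -- By the modular law, one complement P of U ∩ W in V cuts out complements in U and in W.
  have hdec : ∀ L : Submodule K V, U ⊓ W ≤ L → U ⊓ W ⊔ L ⊓ P = L := fun L hL => by
    rw [inf_comm L P, ← sup_inf_assoc_of_le P hL, hP.sup_eq_top, top_inf_eq]
  have hrank : ∀ L : Submodule K V, U ⊓ W ≤ L →
      Module.finrank K (L ⊓ P : Submodule K V) + d = Module.finrank K L := fun L hL => by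
    have h := Submodule.finrank_sup_add_finrank_inf_eq (U ⊓ W) (L ⊓ P)
    have hbot : U ⊓ W ⊓ (L ⊓ P) = ⊥ :=
      le_bot_iff.1 ((inf_le_inf_left _ inf_le_right).trans hP.inf_eq_bot.le)
    rw [hdec L hL, hbot, finrank_bot] at h
    have hd : Module.finrank K (U ⊓ W : Submodule K V) = d := hx
    omega
  have hrU := hrank U inf_le_left
  have hrW := hrank W inf_le_right
  rw [hU, Gr.finrank_space, ← hU] at hrU
  rw [hW, Gr.finrank_space, ← hW] at hrW
  have hrC : Module.finrank K C = r := by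
    have h1 := Submodule.finrank_add_eq_of_isCompl hC
    have h2 := finrank_sup_of_mem_stratum hx
    rw [← hU, ← hW] at h2
    omega
  obtain ⟨f₁, hf₁⟩ := exists_span_range_eq (L := U ⊓ W) hx
  obtain ⟨f₂, hf₂⟩ := exists_span_range_eq (L := U ⊓ P) (r := k - d) (by omega)
  obtain ⟨f₃, hf₃⟩ := exists_span_range_eq (L := W ⊓ P) (r := l - d) (by omega)
  obtain ⟨f₄, hf₄⟩ := exists_span_range_eq hrC
  let f : Fin d ⊕ Fin (k - d) ⊕ Fin (l - d) ⊕ Fin r → V :=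
    Sum.elim f₁ (Sum.elim f₂ (Sum.elim f₃ f₄))
  have h1 : U ⊓ W ≤ Submodule.span K (Set.range f) := by
    rw [← hf₁]
    exact Submodule.span_mono (Set.range_subset_iff.2 fun i => ⟨Sum.inl i, rfl⟩)
  have h2 : U ⊓ P ≤ Submodule.span K (Set.range f) := by
    rw [← hf₂]
    exact Submodule.span_mono (Set.range_subset_iff.2 fun i => ⟨Sum.inr (Sum.inl i), rfl⟩)
  have h3 : W ⊓ P ≤ Submodule.span K (Set.range f) := by
    rw [← hf₃]
    exact Submodule.span_mono
      (Set.range_subset_iff.2 fun i => ⟨Sum.inr (Sum.inr (Sum.inl i)), rfl⟩)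
  have h4 : C ≤ Submodule.span K (Set.range f) := by
    rw [← hf₄]
    exact Submodule.span_mono
      (Set.range_subset_iff.2 fun i => ⟨Sum.inr (Sum.inr (Sum.inr i)), rfl⟩)
  have hspan : ⊤ ≤ Submodule.span K (Set.range f) := by
    have hUf := sup_le h1 h2
    have hWf := sup_le h1 h3
    rw [hdec U inf_le_left] at hUf
    rw [hdec W inf_le_right] at hWf
    rw [← hC.sup_eq_top]
    exact sup_le (sup_le hUf hWf) h4
  have hcard : Fintype.card (Fin d ⊕ Fin (k - d) ⊕ Fin (l - d) ⊕ Fin r) =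
      Module.finrank K V := by
    simp only [Fintype.card_sum, Fintype.card_fin]
    omega
  refine ⟨basisOfTopLeSpanOfCardEqFinrank f hspan hcard, ?_, ?_⟩
  · rw [coe_basisOfTopLeSpanOfCardEqFinrank, ← hdec U inf_le_left, ← hf₁, ← hf₂,
      ← Submodule.span_union]
    congr 1
    ext y
    simp [f]
  · rw [coe_basisOfTopLeSpanOfCardEqFinrank, ← hdec W inf_le_right, ← hf₁, ← hf₃,
      ← Submodule.span_union]
    congr 1
    ext y
    simp [f]

/-- Two pairs with the same d have adapted bases indexed by the same type, and the linear map
matching these bases carries one pair to the other. -/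
theorem stratum_eq_orbit [Module.Finite K V] {d : ℕ} {x : X K V k l}
    (hx : x ∈ stratum K V k l d) (hd : k + l ≤ Module.finrank K V + d) (hdk : d ≤ k)
    (hdl : d ≤ l) : stratum K V k l d = MulAction.orbit (V ≃ₗ[K] V) x := by
  apply Set.Subset.antisymm
  · intro y hy
    have hr : Module.finrank K V + d = k + l + (Module.finrank K V + d - (k + l)) := by omega
    obtain ⟨b, hbU, hbW⟩ := exists_adapted_basis hx hr hdk hdl
    obtain ⟨b', hbU', hbW'⟩ := exists_adapted_basis hy hr hdk hdl
    have hmap : ∀ s, (Submodule.span K (b '' s)).map (b.equiv b' (Equiv.refl _) : V →ₗ[K] V) =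
        Submodule.span K (b' '' s) := fun s => by
      rw [Submodule.map_span, ← Set.image_comp]
      congr 1
      refine Set.image_congr fun i _ => ?_
      simp
    refine ⟨b.equiv b' (Equiv.refl _), X.ext (Gr.ext ?_) (Gr.ext ?_)⟩
    · change x.U.space.map _ = y.U.space
      rw [hbU, hbU', hmap]
    · change x.W.space.map _ = y.W.space
      rw [hbW, hbW', hmap]
  · rintro _ ⟨g, rfl⟩
    exact (finrank_inf_smul g x).trans hx

/-- Provides a cell inside X_d, and so a point from which the GL(V)-orbit can be formed. -/
theorem exists_isAdapted {d : ℕ} (hk : k ≤ n) (hd : k + l ≤ n + d) (hdk : d ≤ k) (hdl : d ≤ l) :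
    ∃ A A' : Finset (Fin n), IsAdapted A A' d (k + l - d) ∧ A.card = k ∧ A'.card = l := by
  let A : Finset (Fin n) := Finset.univ.filter fun a => (a : ℕ) < k
  let A' : Finset (Fin n) := Finset.univ.filter fun a =>
    (a : ℕ) < d ∨ k ≤ (a : ℕ) ∧ (a : ℕ) < k + l - d
  have h : IsAdapted A A' d (k + l - d) := by
    constructor
    · intro a
      simp only [A, A', Finset.mem_filter, Finset.mem_univ, true_and]
      omega
    · intro a
      simp only [A, A', Finset.mem_filter, Finset.mem_univ, true_and]
      omega
  have hA : A.card = k := card_filter_lt hk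
  refine ⟨A, A', h, hA, ?_⟩
  have hi : A ∩ A' = Finset.univ.filter fun a : Fin n => (a : ℕ) < d := by
    ext a
    rw [Finset.mem_inter, h.inter]
    simp
  have hu : A ∪ A' = Finset.univ.filter fun a : Fin n => (a : ℕ) < k + l - d := by
    ext a
    rw [Finset.mem_union, h.union]
    simp
  have hcard := Finset.card_union_add_card_inter A A'
  rw [hi, hu, card_filter_lt (by omega), card_filter_lt (by omega)] at hcard
  omega

end SingleOrbit

end DoubleGrassmannian

theorem theorem6 {K V : Type*} [Field K] [IsAlgClosed K] [AddCommGroup V] [Module K V]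
    {n : ℕ} (v : Module.Basis (Fin n) K V) {k l d : ℕ}
    (hk : 0 < k) (hkn : k < n) (hl : 0 < l) (hln : l < n)
    (hd : k + l ≤ n + d) (hdk : d ≤ k) (hdl : d ≤ l) :
    (∃ x : DoubleGrassmannian.X K V k l,
      DoubleGrassmannian.stratum K V k l d = MulAction.orbit (V ≃ₗ[K] V) x) ∧
    {O : Set (DoubleGrassmannian.X K V k l) |
        DoubleGrassmannian.IsMinimalOrbit v O ∧
        O ⊆ DoubleGrassmannian.stratum K V k l d}.ncard
      = (k + l - 2 * d).choose (k - d) ∧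
    ∀ O : Set (DoubleGrassmannian.X K V k l),
      DoubleGrassmannian.IsMinimalOrbit v O →
      O ⊆ DoubleGrassmannian.stratum K V k l d →
      IsClosed (Subtype.val ⁻¹' O : Set (DoubleGrassmannian.stratum K V k l d)) ∧
      topologicalKrullDim O = (((k - d) * (l - d) : ℕ) : WithBot ℕ∞) ∧
      ∃ (C : Set (DoubleGrassmannian.Gr K V k)) (C' : Set (DoubleGrassmannian.Gr K V l)),
        DoubleGrassmannian.IsSchubertCell v C ∧ DoubleGrassmannian.IsSchubertCell v C' ∧
        O = {x | x.U ∈ C ∧ x.W ∈ C'} := by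
  have hfin : Module.Finite K V := Module.Finite.of_basis v
  have hn : Module.finrank K V = n := by
    rw [Module.finrank_eq_card_basis v, Fintype.card_fin]
  have hdn : d ≤ n := hdk.trans hkn.le
  refine ⟨?_, DoubleGrassmannian.ncard_minimalOrbits hdk hdl hd hdn, fun O hO hOd => ?_⟩
  · obtain ⟨A, A', h, hA, hA'⟩ := DoubleGrassmannian.exists_isAdapted hkn.le hd hdk hdl
    obtain ⟨x, hx⟩ := DoubleGrassmannian.cell_nonempty (v := v) hA hA'
    exact ⟨x, DoubleGrassmannian.stratum_eq_orbit
      (DoubleGrassmannian.cell_subset_stratum h hdk hd hx) (by rw [hn]; exact hd) hdk hdl⟩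
  · obtain ⟨A, A', h, hA, hA', rfl⟩ :=
      (DoubleGrassmannian.isMinimalOrbit_iff hdk hd hdn).1 ⟨hO, hOd⟩
    exact ⟨DoubleGrassmannian.isClosed_preimage_cell h hA hA' hdn,
      DoubleGrassmannian.topologicalKrullDim_cell h hA hA' hdn, _, _,
      DoubleGrassmannian.isSchubertCell_jumps hA, DoubleGrassmannian.isSchubertCell_jumps hA', rfl⟩
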